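/- **Griffiths-type theorem for the general Edwards–Anderson model.** Let $d\ge 1$ and $\beta>0$. Write $|x-y|=\sum_i|x_i-y_i|$ on $\mathbb{Z}^d$, $\Lambda_L=\{1,\dots,L\}^d$, $\partial\Lambda_L=\{u\in\mathbb{Z}^d\setminus\Lambda_L: |u-x|=1 \text{ for some } x\in\Lambda_L\}$. Let the couplings $J_{x,y}=J_{y,x}$ ($|x-y|=1$) be identically distributed real random variables and the fields $h_x$ ($x\in\mathbb{Z}^d$) be identically distributed real random variables (constants are allowed), all of them jointly independent, with $\mathbb{E}|J_{x,y}|<\infty$ and $\mathbb{E}|h_x|<\infty$. For $\sigma\in\{1,-1\}^{\Lambda_L}$ and $b\in[-1,1]^{\partial\Lambda_L}$ put $$H_L(\sigma;b)=-\sum_{\{x,y\}\subset\Lambda_L,\,|x-y|=1}J_{x,y}\sigma_x\sigma_y-\sum_{x\in\Lambda_L,\,u\in\partial\Lambda_L,\,|x-u|=1}J_{x,u}\sigma_xb_u-\sum_{x\in\Lambda_L}h_x\sigma_x,$$ and for two replicas $$H^{(2)}_L(\sigma^1,\sigma^2;\lambda,b)=H_L(\sigma^1;b)+H_L(\sigma^2;b)-\lambda\sum_{x\in\Lambda_L}\sigma^1_x\sigma^2_x,\qquad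 Z^{(2)}_L(\lambda;b)=\sum_{\sigma^1,\sigma^2}e^{-\beta H^{(2)}_L(\sigma^1,\sigma^2;\lambda,b)}.$$ Let $\langle\cdot\rangle^{(2)}_{L,\lambda;b}$ be the corresponding Gibbs expectation, $R_L=L^{-d}\sum_{x\in\Lambda_L}\sigma^1_x\sigma^2_x$ the replica overlap, and $$f^{(2)}(\beta,\lambda)=\lim_{L\to\infty}-\frac{1}{\beta L^d}\,\mathbb{E}\log Z^{(2)}_L(\lambda;b_L),$$ where $b_L$ is a boundary condition that may depend measurably on the disorder. Put $$q_{\rm jump}=\frac12\Bigl\{-\lim_{\lambda\downarrow0}\frac{\partial}{\partial\lambda}f^{(2)}(\beta,\lambda)+\lim_{\lambda\uparrow0}\frac{\partial}{\partial\lambda}f^{(2)}(\beta,\lambda)\Bigr\},$$ where the limits are taken through values of $\lambda$ at which the derivative exists, and $$q_{\rm br}=\limsup_{L\to\infty}\sqrt{\mathbb{E}\langle R_L^2\rangle^{(2)}_{L,0;0}-\bigl(\mathbb{E}\langle R_L\rangle^{(2)}_{L,0;0}\bigr)^2}$$ (open boundary condition $b=0$ and $\lambda=0$). Then $f^{(2)}(\beta,\lambda)$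 exists for all $\lambda\in\mathbb{R}$ and does not depend on the boundary condition, it is differentiable in $\lambda$ off a countable set, the two one-sided limits in $q_{\rm jump}$ exist, and $$q_{\rm jump}\ge\frac{(q_{\rm br})^2}{4}.$$ In particular, if $q_{\rm br}>0$, then $f^{(2)}(\beta,\lambda)$ is not differentiable in $\lambda$ at $\lambda=0$. -/

import Mathlib

open MeasureTheory ProbabilityTheory Filter Topology

namespace EdwardsAnderson

/-- Sites of the hypercubic lattice `ℤ^d`. -/
abbrev Site (d : ℕ) : Type := Fin d → ℤ

/-- The nearest-neighbour graph of `ℤ^d`: `x` and `y` are adjacent iff `‖x - y‖₁ = 1`. -/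
def lattice (d : ℕ) : SimpleGraph (Site d) where
  Adj x y := ∑ i, |x i - y i| = 1
  symm := ⟨fun x y hxy => by simpa only [abs_sub_comm] using hxy⟩
  loopless := ⟨fun x hx => by simp at hx⟩

instance (d : ℕ) : DecidableRel (lattice d).Adj :=
  fun x y => inferInstanceAs (Decidable (∑ i, |x i - y i| = 1))

/-- The cube `Λ_L = {1, …, L}^d`. -/
noncomputable def box (d L : ℕ) : Finset (Site d) :=
  Fintype.piFinset fun _ => Finset.Icc (1 : ℤ) (L : ℤ)

/-- The bonds of a finite region: unordered pairs of neighbouring sites, both in the region. -/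
noncomputable def bonds {d : ℕ} (Λ : Finset (Site d)) : Finset (Sym2 (Site d)) :=
  Λ.sym2.filter fun e => e ∈ (lattice d).edgeSet

/-- The boundary of a finite region: the sites outside with a neighbour inside. (The `biUnion`
is only a finite set that contains all sites with a neighbour inside, see `mem_boundary`.) -/
noncomputable def boundary {d : ℕ} (Λ : Finset (Site d)) : Finset (Site d) :=
  (Λ.biUnion fun x => Fintype.piFinset fun i => Finset.Icc (x i - 1) (x i + 1)).filter
    fun u => u ∉ Λ ∧ ∃ x ∈ Λ, (lattice d).Adj u x

/-- The boundary bonds: pairs `(x, u)` of neighbours with `x` inside and `u` in the boundary. -/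
noncomputable def boundaryBonds {d : ℕ} (Λ : Finset (Site d)) : Finset (Site d × Site d) :=
  (Λ ×ˢ boundary Λ).filter fun p => (lattice d).Adj p.1 p.2

theorem mem_boundary {d : ℕ} (Λ : Finset (Site d)) (u : Site d) :
    u ∈ boundary Λ ↔ u ∉ Λ ∧ ∃ x ∈ Λ, (lattice d).Adj u x := by
  simp only [boundary, Finset.mem_filter, Finset.mem_biUnion, Fintype.mem_piFinset,
    Finset.mem_Icc, and_iff_right_iff_imp]
  rintro ⟨_, x, hx, hux⟩
  refine ⟨x, hx, fun i => ?_⟩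
  have h1 : |u i - x i| ≤ ∑ j, |u j - x j| :=
    Finset.single_le_sum (f := fun j => |u j - x j|) (fun j _ => abs_nonneg _) (Finset.mem_univ i)
  have h2 : ∑ j, |u j - x j| = 1 := hux
  rw [h2, abs_le] at h1
  constructor <;> linarith [h1.1, h1.2]

/-- Spin configurations on a region: each spin is `1` or `-1`. -/
abbrev Config {d : ℕ} (Λ : Finset (Site d)) : Type := {x // x ∈ Λ} → ℤˣ

/-- The spin `σ_x ∈ {1, -1}` as a real number (only used for `x ∈ Λ`). -/
def spin {d : ℕ} {Λ : Finset (Site d)} (σ : Config Λ) (x : Site d) : ℝ :=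
  if hx : x ∈ Λ then (((σ ⟨x, hx⟩ : ℤˣ) : ℤ) : ℝ) else 0

/-- The Hamiltonian of the Edwards–Anderson model on `Λ` for couplings `J`, fields `h` and
boundary configuration `b` (of which only the values on `boundary Λ` matter):
`- ∑_{bonds} J_{xy} σ_x σ_y - ∑_{boundary bonds} J_{xu} σ_x b_u - ∑_x h_x σ_x`. -/
noncomputable def hamiltonian {d : ℕ} (Λ : Finset (Site d)) (J : Sym2 (Site d) → ℝ)
    (h b : Site d → ℝ) (σ : Config Λ) : ℝ :=
  - ∑ e ∈ bonds Λ, J e * (e.map (spin σ)).mul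
    - ∑ p ∈ boundaryBonds Λ, J s(p.1, p.2) * spin σ p.1 * b p.2
    - ∑ x ∈ Λ, h x * spin σ x

/-- The two-replica Hamiltonian with replica coupling `lam`. -/
noncomputable def hamiltonian2 {d : ℕ} (Λ : Finset (Site d)) (J : Sym2 (Site d) → ℝ)
    (h b : Site d → ℝ) (lam : ℝ) (σ₁ σ₂ : Config Λ) : ℝ :=
  hamiltonian Λ J h b σ₁ + hamiltonian Λ J h b σ₂ - lam * ∑ x ∈ Λ, spin σ₁ x * spin σ₂ x

/-- The two-replica partition function at inverse temperature `β`. -/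
noncomputable def partition2 {d : ℕ} (Λ : Finset (Site d)) (β lam : ℝ)
    (J : Sym2 (Site d) → ℝ) (h b : Site d → ℝ) : ℝ :=
  ∑ σ₁ : Config Λ, ∑ σ₂ : Config Λ, Real.exp (-β * hamiltonian2 Λ J h b lam σ₁ σ₂)

/-- The two-replica thermal expectation of an observable `F`. -/
noncomputable def gibbs2 {d : ℕ} (Λ : Finset (Site d)) (β lam : ℝ)
    (J : Sym2 (Site d) → ℝ) (h b : Site d → ℝ) (F : Config Λ → Config Λ → ℝ) : ℝ :=
  (partition2 Λ β lam J h b)⁻¹ *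
    ∑ σ₁ : Config Λ, ∑ σ₂ : Config Λ,
      F σ₁ σ₂ * Real.exp (-β * hamiltonian2 Λ J h b lam σ₁ σ₂)

/-- The replica overlap `R_L^{1,2} = L^{-d} ∑_{x ∈ Λ_L} σ¹_x σ²_x`. -/
noncomputable def overlap (d L : ℕ) (σ₁ σ₂ : Config (box d L)) : ℝ :=
  ((L : ℝ) ^ d)⁻¹ * ∑ x ∈ box d L, spin σ₁ x * spin σ₂ x

/-- A (possibly disorder-dependent) boundary condition: for each `L`, a random boundary
configuration with values in `[-1, 1]` on the boundary of `Λ_L`. Any measurable function of the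
couplings and fields is allowed. -/
def IsBoundaryCondition {d : ℕ} {Ω : Type*} [MeasurableSpace Ω]
    (b : ℕ → Ω → Site d → ℝ) : Prop :=
  ∀ L : ℕ, ∀ u ∈ boundary (box d L),
    Measurable (fun ω => b L ω u) ∧ ∀ ω, |b L ω u| ≤ 1

section Disorder

variable {d : ℕ} {Ω : Type*} [MeasurableSpace Ω]

/-- The averaged finite-volume two-replica free energy density
`f_L^{(2)}(β, lam; b) = -(β L^d)⁻¹ 𝔼 log Z_L^{(2)}`. -/
noncomputable def freeEnergy2Box (μ : Measure Ω) (J : Sym2 (Site d) → Ω → ℝ)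
    (h : Site d → Ω → ℝ) (β : ℝ) (b : ℕ → Ω → Site d → ℝ) (L : ℕ) (lam : ℝ) : ℝ :=
  -(1 / (β * (L : ℝ) ^ d)) *
    ∫ ω, Real.log (partition2 (box d L) β lam (fun e => J e ω) (fun x => h x ω) (b L ω)) ∂μ

/-- The infinite-volume two-replica free energy density `f^{(2)}(β, lam)`, taken with the open
boundary condition `b = 0`. -/
noncomputable def freeEnergy2 (μ : Measure Ω) (J : Sym2 (Site d) → Ω → ℝ)
    (h : Site d → Ω → ℝ) (β lam : ℝ) : ℝ :=
  limUnder atTop fun L : ℕ => freeEnergy2Box μ J h β (fun _ _ _ => 0) L lam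

/-- `lam ↓ 0` through the points where `f` is differentiable. -/
def rightFilter (f : ℝ → ℝ) : Filter ℝ := 𝓝[{l | 0 < l ∧ DifferentiableAt ℝ f l}] 0

/-- `lam ↑ 0` through the points where `f` is differentiable. -/
def leftFilter (f : ℝ → ℝ) : Filter ℝ := 𝓝[{l | l < 0 ∧ DifferentiableAt ℝ f l}] 0

/-- The jump order parameter: half the jump of the `lam`-derivative of `f^{(2)}` at `lam = 0`. -/
noncomputable def qJump (μ : Measure Ω) (J : Sym2 (Site d) → Ω → ℝ)
    (h : Site d → Ω → ℝ) (β : ℝ) : ℝ :=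
  (1 / 2) *
    (-(limUnder (rightFilter (freeEnergy2 μ J h β)) (deriv (freeEnergy2 μ J h β)))
      + limUnder (leftFilter (freeEnergy2 μ J h β)) (deriv (freeEnergy2 μ J h β)))

/-- The disorder average `𝔼 ⟨(R_L^{1,2})^k⟩^{(2)}` at `lam = 0` with open boundary condition. -/
noncomputable def overlapMoment (μ : Measure Ω) (J : Sym2 (Site d) → Ω → ℝ)
    (h : Site d → Ω → ℝ) (β : ℝ) (k L : ℕ) : ℝ :=
  ∫ ω, gibbs2 (box d L) β 0 (fun e => J e ω) (fun x => h x ω) (fun _ => 0)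
    (fun σ₁ σ₂ => overlap d L σ₁ σ₂ ^ k) ∂μ

/-- The broadening order parameter: the limsup of the standard deviation of the overlap. -/
noncomputable def qBr (μ : Measure Ω) (J : Sym2 (Site d) → Ω → ℝ)
    (h : Site d → Ω → ℝ) (β : ℝ) : ℝ :=
  limsup (fun L : ℕ =>
    Real.sqrt (overlapMoment μ J h β 2 L - overlapMoment μ J h β 1 L ^ 2)) atTop

end Disorder

end EdwardsAnderson

open EdwardsAnderson

/-! Write `p lam` for the limit of `L^{-d} log Z`, so that `-f = p / β`. The proof rests on two
facts about this limit: it exists in `L¹` of the disorder as a constant, and it is convex in `lam`.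

Existence of the limit. Cutting a region into disjoint pieces changes `log Z` by at most `2β` times
the strength of the severed bonds (`abs_logPartition2_union_sub_le`). Hence the box is a union of
translates of a cube of side `M`, up to a surface error per site that is small for large `M` and a
leftover of vanishing density. The contributions of the cubes are independent with a common law and
a finite mean, so an `L¹` weak law of large numbers (`exists_integral_abs_sum_sub_le`) applies.
First moments suffice throughout; no concentration inequality is used. The same surface estimate,
applied pathwise, removes the boundary condition.

From the limit to the overlap. At `lam = 0` the exponential moment of `β lam L^d R_L` is the ratio
of the partition functions at `lam` and `0`, hence is about `exp (L^d (p lam - p 0))`. Let `l ≤ r`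
be the one-sided derivatives of `-f` at zero. For `a > r` some `lam > 0` satisfies `p lam - p 0 < β
lam a`, and the Chernoff bound makes `R_L ≥ a` unlikely; a negative `lam` treats `R_L ≤ a'` for `a'
< l`. The random fluctuation of the exponent is absorbed by the `L¹` convergence
(`tendsto_integral_gibbs2_overlap_tail`).

So the overlap concentrates on every neighbourhood of `[l, r]`, and its standard deviation is
asymptotically at most half the length of this interval, which is the jump (`qBr_le_half_sub`). This
yields the stronger bound `q_br ≤ q_jump`; the stated one follows from `0 ≤ q_br ≤ 1`. -/

namespace EdwardsAnderson

/-! ### Log-sum-exp and convex functions on the line -/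

section Analysis

/-- The logarithm of a sum of exponentials is `1`-Lipschitz for the supremum distance. -/
theorem abs_log_sum_exp_sub_le {α : Type*} [Fintype α] [Nonempty α] (f g : α → ℝ) (C : ℝ)
    (hfg : ∀ a, |f a - g a| ≤ C) :
    |Real.log (∑ a, Real.exp (f a)) - Real.log (∑ a, Real.exp (g a))| ≤ C := by
  have key : ∀ f g : α → ℝ, (∀ a, |f a - g a| ≤ C) →
      Real.log (∑ a, Real.exp (f a)) ≤ C + Real.log (∑ a, Real.exp (g a)) := by
    intro f g hfg
    have hg : 0 < ∑ a, Real.exp (g a) :=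
      Finset.sum_pos (fun a _ => Real.exp_pos _) Finset.univ_nonempty
    have hf : 0 < ∑ a, Real.exp (f a) :=
      Finset.sum_pos (fun a _ => Real.exp_pos _) Finset.univ_nonempty
    rw [← Real.log_exp C, ← Real.log_mul (Real.exp_pos C).ne' hg.ne']
    refine Real.log_le_log hf ?_
    rw [Finset.mul_sum]
    refine Finset.sum_le_sum fun a _ => ?_
    rw [← Real.exp_add]
    exact Real.exp_le_exp.2 (by linarith [(abs_le.1 (hfg a)).2])
  rw [abs_le]
  have h1 := key f g hfg
  have h2 := key g f fun a => by rw [abs_sub_comm]; exact hfg a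
  constructor <;> linarith

/-- The logarithm of a sum of exponentials of affine functions is convex. -/
theorem convexOn_log_sum_exp {α : Type*} [Fintype α] [Nonempty α] (f g : α → ℝ) :
    ConvexOn ℝ Set.univ fun l : ℝ => Real.log (∑ a, Real.exp (f a + l * g a)) := by
  have hpos : ∀ l : ℝ, 0 < ∑ a, Real.exp (f a + l * g a) := fun l =>
    Finset.sum_pos (fun a _ => Real.exp_pos _) Finset.univ_nonempty
  refine ⟨convex_univ, fun x _ y _ a b ha hb hab => ?_⟩
  simp only [smul_eq_mul]
  set u := Real.log (∑ a, Real.exp (f a + x * g a))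
  set v := Real.log (∑ a, Real.exp (f a + y * g a))
  rw [Real.log_le_iff_le_exp (hpos _)]
  -- Normalized by its own logarithm, each sum has total mass one. Convexity of `exp`, term by term,
  -- then bounds the mass at the intermediate point by `a + b = 1`; this plays the role of Hölder's
  -- inequality.
  have hsum : ∀ l : ℝ, ∑ i, Real.exp (f i + l * g i -
      Real.log (∑ a, Real.exp (f a + l * g a))) = 1 := by
    intro l
    simp only [Real.exp_sub, Real.exp_log (hpos l), ← Finset.sum_div]
    exact div_self (hpos l).ne'
  have hle : ∑ i, Real.exp (f i + (a * x + b * y) * g i - (a * u + b * v)) ≤ 1 := by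
    calc _ ≤ ∑ i, (a * Real.exp (f i + x * g i - u) + b * Real.exp (f i + y * g i - v)) := by
          refine Finset.sum_le_sum fun i _ => ?_
          have := convexOn_exp.2 (Set.mem_univ (f i + x * g i - u))
            (Set.mem_univ (f i + y * g i - v)) ha hb hab
          simp only [smul_eq_mul] at this
          refine le_trans (le_of_eq ?_) this
          congr 1
          have : f i = (a + b) * f i := by rw [hab, one_mul]
          linear_combination this
      _ = 1 := by
          rw [Finset.sum_add_distrib, ← Finset.mul_sum, ← Finset.mul_sum, hsum, hsum, mul_one,
            mul_one, hab]
  simp only [Real.exp_sub _ (a * u + b * v), ← Finset.sum_div] at hle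
  rwa [div_le_one (Real.exp_pos _)] at hle

variable {p : ℝ → ℝ}

theorem _root_.ConvexOn.hasDerivWithinAt_Ioi (hp : ConvexOn ℝ Set.univ p) (x : ℝ) :
    HasDerivWithinAt p (derivWithin p (Set.Ioi x) x) (Set.Ioi x) x :=
  hp.hasDerivWithinAt_rightDeriv_of_mem_interior (by simp)

theorem _root_.ConvexOn.hasDerivWithinAt_Iio (hp : ConvexOn ℝ Set.univ p) (x : ℝ) :
    HasDerivWithinAt p (derivWithin p (Set.Iio x) x) (Set.Iio x) x :=
  hp.hasDerivWithinAt_leftDeriv_of_mem_interior (by simp)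

/-- A convex function on the line is differentiable off a countable set. -/
theorem _root_.ConvexOn.countable_not_differentiableAt (hp : ConvexOn ℝ Set.univ p) :
    {x : ℝ | ¬ DifferentiableAt ℝ p x}.Countable := by
  have hmono : Monotone fun x => derivWithin p (Set.Ioi x) x := by
    have := hp.monotoneOn_rightDeriv
    rw [interior_univ] at this
    exact monotoneOn_univ.1 this
  -- The right derivative is monotone, hence continuous off a countable set. Where it is continuous,
  -- it equals the left derivative: right derivatives at `y < x` lie below the left derivative at
  -- `x`, and `y` tends to `x`.
  refine hmono.countable_not_continuousAt.mono ?_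
  intro x hx hcont
  refine hx ?_
  have hle : derivWithin p (Set.Iio x) x ≤ derivWithin p (Set.Ioi x) x :=
    hp.leftDeriv_le_rightDeriv_of_mem_interior (by simp)
  have hge : derivWithin p (Set.Ioi x) x ≤ derivWithin p (Set.Iio x) x := by
    have ht : Tendsto (fun y => derivWithin p (Set.Ioi y) y) (𝓝[<] x)
        (𝓝 (derivWithin p (Set.Ioi x) x)) := hcont.tendsto.mono_left nhdsWithin_le_nhds
    refine le_of_tendsto ht ?_
    filter_upwards [self_mem_nhdsWithin] with y hy
    exact (hp.le_slope_of_hasDerivWithinAt_Ioi (Set.mem_univ _) (Set.mem_univ _) hy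
      (hp.hasDerivWithinAt_Ioi y)).trans
      (hp.slope_le_of_hasDerivWithinAt_Iio (Set.mem_univ _) (Set.mem_univ _) hy
        (hp.hasDerivWithinAt_Iio x))
  have h1 := hasDerivWithinAt_Ioi_iff_Ici.1 (hp.hasDerivWithinAt_Ioi x)
  have h2 := hasDerivWithinAt_Iio_iff_Iic.1 (hp.hasDerivWithinAt_Iio x)
  rw [le_antisymm hle hge] at h2
  have h3 := h2.union h1
  rw [Set.Iic_union_Ici, hasDerivWithinAt_univ] at h3
  exact h3.differentiableAt

/-- The derivatives of a convex function, at its points of differentiability to the right of a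
point, converge to the right derivative at that point. -/
theorem _root_.ConvexOn.tendsto_deriv_right (hp : ConvexOn ℝ Set.univ p) (x : ℝ) :
    Tendsto (deriv p) (𝓝[{l | x < l ∧ DifferentiableAt ℝ p l}] x)
      (𝓝 (derivWithin p (Set.Ioi x) x)) := by
  have hcont : Continuous p :=
    continuousOn_univ.1 (hp.continuousOn isOpen_univ)
  refine tendsto_order.2 ⟨fun a ha => ?_, fun a ha => ?_⟩
  · filter_upwards [self_mem_nhdsWithin] with y hy
    exact ha.trans_le ((hp.le_slope_of_hasDerivWithinAt_Ioi (Set.mem_univ _) (Set.mem_univ _) hy.1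
      (hp.hasDerivWithinAt_Ioi x)).trans
      (hp.slope_le_of_hasDerivWithinAt_Iio (Set.mem_univ _) (Set.mem_univ _) hy.1
        hy.2.hasDerivAt.hasDerivWithinAt))
  -- Fix a chord from `x` to `z` of slope below `a`. Moving its left end to a nearby `y` keeps the
  -- slope below `a`, and the derivative at `y` is at most that slope.
  · have hs : Tendsto (slope p x) (𝓝[>] x) (𝓝 (derivWithin p (Set.Ioi x) x)) :=
      (hasDerivWithinAt_iff_tendsto_slope' (by simp)).1 (hp.hasDerivWithinAt_Ioi x)
    obtain ⟨z, hz, hxz⟩ := ((hs.eventually (gt_mem_nhds ha)).and self_mem_nhdsWithin).exists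
    have hxz : x < z := hxz
    have hc : ContinuousAt (fun y => slope p y z) x := by
      simp only [slope_def_field]
      exact ContinuousAt.div (by fun_prop) (by fun_prop) (sub_pos.2 hxz).ne'
    have he : ∀ᶠ y in 𝓝 x, slope p y z < a := hc.tendsto.eventually (gt_mem_nhds hz)
    filter_upwards [self_mem_nhdsWithin, nhdsWithin_le_nhds he,
      nhdsWithin_le_nhds (gt_mem_nhds hxz)] with y hy hya hyz
    exact (hp.le_slope_of_hasDerivWithinAt_Ioi (Set.mem_univ _) (Set.mem_univ _) hyz
        hy.2.hasDerivAt.hasDerivWithinAt).trans_lt hya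

/-- The derivatives of a convex function, at its points of differentiability to the left of a
point, converge to the left derivative at that point. -/
theorem _root_.ConvexOn.tendsto_deriv_left (hp : ConvexOn ℝ Set.univ p) (x : ℝ) :
    Tendsto (deriv p) (𝓝[{l | l < x ∧ DifferentiableAt ℝ p l}] x)
      (𝓝 (derivWithin p (Set.Iio x) x)) := by
  have hcont : Continuous p :=
    continuousOn_univ.1 (hp.continuousOn isOpen_univ)
  refine tendsto_order.2 ⟨fun a ha => ?_, fun a ha => ?_⟩
  · have hs : Tendsto (slope p x) (𝓝[<] x) (𝓝 (derivWithin p (Set.Iio x) x)) :=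
      (hasDerivWithinAt_iff_tendsto_slope' (by simp)).1 (hp.hasDerivWithinAt_Iio x)
    obtain ⟨z, hz, hxz⟩ := ((hs.eventually (lt_mem_nhds ha)).and self_mem_nhdsWithin).exists
    have hxz : z < x := hxz
    rw [slope_comm] at hz
    have hc : ContinuousAt (fun y => slope p z y) x := by
      simp only [slope_def_field]
      exact ContinuousAt.div (by fun_prop) (by fun_prop) (sub_pos.2 hxz).ne'
    have he : ∀ᶠ y in 𝓝 x, a < slope p z y := hc.tendsto.eventually (lt_mem_nhds hz)
    filter_upwards [self_mem_nhdsWithin, nhdsWithin_le_nhds he,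
      nhdsWithin_le_nhds (lt_mem_nhds hxz)] with y hy hya hyz
    exact hya.trans_le (hp.slope_le_of_hasDerivWithinAt_Iio (Set.mem_univ _) (Set.mem_univ _) hyz
        hy.2.hasDerivAt.hasDerivWithinAt)
  · filter_upwards [self_mem_nhdsWithin] with y hy
    exact ((hp.le_slope_of_hasDerivWithinAt_Ioi (Set.mem_univ _) (Set.mem_univ _) hy.1
      hy.2.hasDerivAt.hasDerivWithinAt).trans
      (hp.slope_le_of_hasDerivWithinAt_Iio (Set.mem_univ _) (Set.mem_univ _) hy.1
        (hp.hasDerivWithinAt_Iio x))).trans_lt ha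

/-- Slopes of short chords approach the one-sided derivative. The point found here at `x = 0`
becomes the parameter of the Chernoff bound for the upper tail; the mirror statement below serves
the lower tail. -/
theorem _root_.ConvexOn.exists_lt_of_derivWithin_Ioi_lt (hp : ConvexOn ℝ Set.univ p) {x a : ℝ}
    (ha : derivWithin p (Set.Ioi x) x < a) : ∃ y, x < y ∧ p y - p x < a * (y - x) := by
  have hs : Tendsto (slope p x) (𝓝[>] x) (𝓝 (derivWithin p (Set.Ioi x) x)) :=
    (hasDerivWithinAt_iff_tendsto_slope' (by simp)).1 (hp.hasDerivWithinAt_Ioi x)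
  obtain ⟨z, hz, hxz⟩ := ((hs.eventually (gt_mem_nhds ha)).and self_mem_nhdsWithin).exists
  have hxz : x < z := hxz
  rw [slope_def_field, div_lt_iff₀ (sub_pos.2 hxz)] at hz
  exact ⟨z, hxz, hz⟩

theorem _root_.ConvexOn.exists_lt_of_lt_derivWithin_Iio (hp : ConvexOn ℝ Set.univ p) {x a : ℝ}
    (ha : a < derivWithin p (Set.Iio x) x) : ∃ y, y < x ∧ p y - p x < a * (y - x) := by
  have hs : Tendsto (slope p x) (𝓝[<] x) (𝓝 (derivWithin p (Set.Iio x) x)) :=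
    (hasDerivWithinAt_iff_tendsto_slope' (by simp)).1 (hp.hasDerivWithinAt_Iio x)
  obtain ⟨z, hz, hxz⟩ := ((hs.eventually (lt_mem_nhds ha)).and self_mem_nhdsWithin).exists
  have hxz : z < x := hxz
  rw [slope_def_field, lt_div_iff_of_neg (sub_neg.2 hxz)] at hz
  exact ⟨z, hxz, hz⟩

/-- A set with countable complement accumulates at each point from the right. -/
theorem neBot_nhdsWithin_gt_of_countable {q : ℝ → Prop} (hq : {x | ¬ q x}.Countable) (x : ℝ) :
    (𝓝[{l | x < l ∧ q l}] x).NeBot := by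
  rw [← mem_closure_iff_nhdsWithin_neBot, Metric.mem_closure_iff]
  intro ε hε
  obtain ⟨y, hy, hy'⟩ := (hq.dense_compl ℝ).exists_between (show x < x + ε by linarith)
  refine ⟨y, ⟨hy'.1, by simpa using hy⟩, ?_⟩
  rw [dist_comm, Real.dist_eq, abs_of_pos (sub_pos.2 hy'.1)]
  linarith [hy'.2]

/-- A set with countable complement accumulates at each point from the left. -/
theorem neBot_nhdsWithin_lt_of_countable {q : ℝ → Prop} (hq : {x | ¬ q x}.Countable) (x : ℝ) :
    (𝓝[{l | l < x ∧ q l}] x).NeBot := by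
  rw [← mem_closure_iff_nhdsWithin_neBot, Metric.mem_closure_iff]
  intro ε hε
  obtain ⟨y, hy, hy'⟩ := (hq.dense_compl ℝ).exists_between (show x - ε < x by linarith)
  refine ⟨y, ⟨hy'.2, by simpa using hy⟩, ?_⟩
  rw [Real.dist_eq, abs_of_pos (sub_pos.2 hy'.2)]
  linarith [hy'.1]

end Analysis

/-! ### A weak law of large numbers, uniform over finite index sets -/

/-- The weak law of large numbers in `L¹`, for pairwise independent families on any index type. -/
theorem exists_integral_abs_sum_sub_le {Ω ι : Type*} [MeasurableSpace Ω] {μ : Measure Ω}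
    [IsProbabilityMeasure μ] {X : ι → Ω → ℝ} {Y : Ω → ℝ} (hY : Integrable Y μ)
    (hid : ∀ i, IdentDistrib (X i) Y μ μ) (hindep : Pairwise fun i j => IndepFun (X i) (X j) μ)
    {ε : ℝ} (hε : 0 < ε) :
    ∃ n : ℕ, ∀ s : Finset ι, n ≤ s.card →
      ∫ ω, |∑ i ∈ s, X i ω - s.card * ∫ ω, Y ω ∂μ| ∂μ ≤ ε * s.card := by
  have hlim : Tendsto (fun A => ∫ ω, |Y ω - truncation Y A ω| ∂μ) atTop (𝓝 (∫ _, (0 : ℝ) ∂μ)) := by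
    refine tendsto_integral_filter_of_dominated_convergence (fun ω => 2 * |Y ω|)
      (Eventually.of_forall fun A => ?_) (Eventually.of_forall fun A => ?_) (hY.abs.const_mul 2) ?_
    · exact (hY.aestronglyMeasurable.sub hY.aestronglyMeasurable.truncation).norm
    · refine Eventually.of_forall fun ω => ?_
      rw [Real.norm_eq_abs, abs_abs]
      have h1 := abs_sub (Y ω) (truncation Y A ω)
      have h2 := abs_truncation_le_abs_self Y A ω
      linarith
    · refine Eventually.of_forall fun ω => tendsto_const_nhds.congr' ?_
      filter_upwards [eventually_gt_atTop |Y ω|] with A hA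
      rw [truncation_eq_self hA, sub_self, abs_zero]
  rw [integral_zero] at hlim
  obtain ⟨A, hA⟩ := (hlim.eventually (gt_mem_nhds (show 0 < ε / 4 by linarith))).exists
  set t := ∫ ω, truncation Y A ω ∂μ with ht
  set m := ∫ ω, Y ω ∂μ with hm
  have hX : ∀ i, Integrable (X i) μ := fun i => (hid i).integrable_iff.2 hY
  have hTi : ∀ i, Integrable (truncation (X i) A) μ := fun i =>
    (hX i).aestronglyMeasurable.integrable_truncation
  have hTY : Integrable (truncation Y A) μ := hY.aestronglyMeasurable.integrable_truncation
  have hTid : ∀ i, IdentDistrib (truncation (X i) A) (truncation Y A) μ μ := fun i =>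
    (hid i).truncation
  -- The truncation error is a fixed measurable function of the variable, so its mean for each `X i`
  -- equals that for `Y`.
  have hu : Measurable fun x : ℝ => |x - (Set.Ioc (-A) A).indicator id x| :=
    ((measurable_id.sub (measurable_id.indicator measurableSet_Ioc))).abs
  have hdiff : ∀ i, ∫ ω, |X i ω - truncation (X i) A ω| ∂μ ≤ ε / 4 := fun i =>
    (((hid i).comp hu).integral_eq.trans_lt hA).le
  have htm : |t - m| ≤ ε / 4 := by
    rw [ht, hm, abs_sub_comm, ← integral_sub hY hTY]
    exact (abs_integral_le_integral_abs).trans hA.le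
  -- With `δ = ε / 4`, this makes `A² / (2δ) ≤ δ N` once `N ≥ n`. The error budget is `δ N` for
  -- truncating the summands, `2δ N` for the centred truncated sum and `δ N` for the shift of the
  -- mean. The threshold involves only the cardinality of the index set.
  obtain ⟨n, hn⟩ := exists_nat_ge (A ^ 2 / (2 * (ε / 4)) / (ε / 4))
  refine ⟨n, fun s hs => ?_⟩
  set N : ℝ := (s.card : ℝ)
  have hN : A ^ 2 / (2 * (ε / 4)) ≤ ε / 4 * N := by
    have : A ^ 2 / (2 * (ε / 4)) / (ε / 4) ≤ N := hn.trans (Nat.cast_le.2 hs)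
    rw [div_le_iff₀ (by linarith)] at this
    linarith
  set V : Ω → ℝ := fun ω => ∑ i ∈ s, truncation (X i) A ω - N * t with hV
  have hmem : ∀ i, MemLp (truncation (X i) A) 2 μ := fun i =>
    (hX i).aestronglyMeasurable.memLp_truncation
  have hVmem : MemLp V 2 μ := by
    refine MemLp.sub ?_ (memLp_const _)
    exact memLp_finsetSum s fun i _ => hmem i
  have hVint : Integrable V μ := hVmem.integrable (by norm_num)
  have hES : ∫ ω, (∑ i ∈ s, truncation (X i) A) ω ∂μ = N * t := by
    simp only [Finset.sum_apply]
    rw [integral_finsetSum _ fun i _ => hTi i, Finset.sum_congr rfl fun i _ => (hTid i).integral_eq,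
      Finset.sum_const, nsmul_eq_mul]
  have hvar : ∫ ω, V ω ^ 2 ∂μ ≤ N * A ^ 2 := by
    have h1 : ∫ ω, V ω ^ 2 ∂μ = variance (∑ i ∈ s, truncation (X i) A) μ := by
      rw [variance_eq_integral (memLp_finsetSum' s fun i _ => hmem i).aestronglyMeasurable.aemeasurable,
        hES]
      simp [hV, Finset.sum_apply]
    rw [h1, IndepFun.variance_sum (fun i _ => hmem i)]
    · calc _ ≤ ∑ i ∈ s, A ^ 2 := by
            refine Finset.sum_le_sum fun i _ => ?_
            refine (variance_le_expectation_sq (hTi i).aestronglyMeasurable).trans ?_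
            refine (integral_mono_of_nonneg (Eventually.of_forall fun ω => sq_nonneg _)
              (integrable_const (A ^ 2)) (Eventually.of_forall fun ω => ?_)).trans (by simp)
            exact sq_le_sq.2 (abs_truncation_le_bound _ _ _)
        _ = _ := by rw [Finset.sum_const, nsmul_eq_mul]
    · intro i _ j _ hij
      exact (hindep hij).comp (measurable_id.indicator measurableSet_Ioc)
        (measurable_id.indicator measurableSet_Ioc)
  have hNn : 0 ≤ N := Nat.cast_nonneg _
  -- With `c = δ N`, the elementary bound `|V| ≤ V² / (2c) + c / 2` and the variance estimate give
  -- `A² / (2δ) + δ N / 2`. The case `N = 0` is separate because `c` is a divisor.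
  have hVabs : ∫ ω, |V ω| ∂μ ≤ 2 * (ε / 4) * N := by
    rcases hNn.eq_or_lt with h0 | h0
    · have : s = ∅ := by
        exact Finset.card_eq_zero.1 (Nat.cast_eq_zero.1 h0.symm)
      have hz : V = fun _ => 0 := by
        funext ω; simp only [hV, ← h0, this]; simp
      rw [hz, ← h0]; simp
    · have hc : 0 < ε / 4 * N := by positivity
      calc ∫ ω, |V ω| ∂μ ≤ ∫ ω, (1 / (2 * (ε / 4 * N)) * V ω ^ 2 + ε / 4 * N / 2) ∂μ := by
            refine integral_mono hVint.abs ((hVmem.integrable_sq.const_mul _).add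
              (integrable_const _)) fun ω => ?_
            have h2 : 0 ≤ (|V ω| - ε / 4 * N) ^ 2 := sq_nonneg _
            rw [sub_sq, sq_abs] at h2
            simp only
            rw [← sub_nonneg]
            have : 1 / (2 * (ε / 4 * N)) * V ω ^ 2 + ε / 4 * N / 2 - |V ω| =
              (V ω ^ 2 - 2 * |V ω| * (ε / 4 * N) + (ε / 4 * N) ^ 2) / (2 * (ε / 4 * N)) := by
              field_simp
              ring
            rw [this]
            positivity
        _ = 1 / (2 * (ε / 4 * N)) * ∫ ω, V ω ^ 2 ∂μ + ε / 4 * N / 2 := by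
            rw [integral_add (hVmem.integrable_sq.const_mul _) (integrable_const _),
              integral_const_mul]
            simp
        _ ≤ 1 / (2 * (ε / 4 * N)) * (N * A ^ 2) + ε / 4 * N / 2 := by gcongr
        _ = A ^ 2 / (2 * (ε / 4)) + ε / 4 * N / 2 := by field_simp
        _ ≤ _ := by nlinarith
  have hdint : ∀ i, Integrable (fun ω => |X i ω - truncation (X i) A ω|) μ := fun i =>
    ((hX i).sub (hTi i)).abs
  calc _ ≤ ∫ ω, (∑ i ∈ s, |X i ω - truncation (X i) A ω| + |V ω| + N * |t - m|) ∂μ := by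
        refine integral_mono_of_nonneg (Eventually.of_forall fun ω => abs_nonneg _)
          (((integrable_finsetSum _ fun i _ => hdint i).add hVint.abs).add (integrable_const _))
          (Eventually.of_forall fun ω => ?_)
        have e : ∑ i ∈ s, X i ω - N * m =
            ∑ i ∈ s, (X i ω - truncation (X i) A ω) + V ω + N * (t - m) := by
          rw [Finset.sum_sub_distrib]; simp only [hV]; ring
        simp only
        rw [e]
        refine (abs_add_three _ _ _).trans ?_
        rw [abs_mul N, abs_of_nonneg hNn]
        gcongr
        exact Finset.abs_sum_le_sum_abs _ _
    _ = ∑ i ∈ s, ∫ ω, |X i ω - truncation (X i) A ω| ∂μ + ∫ ω, |V ω| ∂μ + N * |t - m| := by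
        have h1 : Integrable (fun ω => ∑ i ∈ s, |X i ω - truncation (X i) A ω|) μ :=
          integrable_finsetSum _ fun i _ => hdint i
        have h2 : Integrable (fun ω => ∑ i ∈ s, |X i ω - truncation (X i) A ω| + |V ω|) μ :=
          h1.add hVint.abs
        rw [integral_add h2 (integrable_const _), integral_add h1 hVint.abs,
          integral_finsetSum _ fun i _ => hdint i]
        simp
    _ ≤ ∑ i ∈ s, ε / 4 + 2 * (ε / 4) * N + N * (ε / 4) := by
        gcongr with i _
        exact hdiff i
    _ = ε * N := by rw [Finset.sum_const, nsmul_eq_mul]; ring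

/-! ### The log partition function for fixed disorder: locality, cutting, translation -/

section Deterministic

variable {d : ℕ}

theorem mem_bonds {Λ : Finset (Site d)} {x y : Site d} :
    s(x, y) ∈ bonds Λ ↔ (x ∈ Λ ∧ y ∈ Λ) ∧ (lattice d).Adj x y := by
  simp [bonds]

theorem mem_boundaryBonds {Λ : Finset (Site d)} {p : Site d × Site d} :
    p ∈ boundaryBonds Λ ↔ p.1 ∈ Λ ∧ p.2 ∉ Λ ∧ (lattice d).Adj p.1 p.2 := by
  simp only [boundaryBonds, Finset.mem_filter, Finset.mem_product, mem_boundary]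
  constructor
  · rintro ⟨⟨h1, h2, -⟩, h4⟩
    exact ⟨h1, h2, h4⟩
  · rintro ⟨h1, h2, h3⟩
    exact ⟨⟨h1, h2, p.1, h1, h3.symm⟩, h3⟩

theorem mem_edgeSet_of_mem_bonds {Λ : Finset (Site d)} {e : Sym2 (Site d)} (he : e ∈ bonds Λ) :
    e ∈ (lattice d).edgeSet :=
  (Finset.mem_filter.1 he).2

theorem mem_edgeSet_of_mem_boundaryBonds {Λ : Finset (Site d)} {p : Site d × Site d}
    (hp : p ∈ boundaryBonds Λ) : s(p.1, p.2) ∈ (lattice d).edgeSet :=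
  (mem_boundaryBonds.1 hp).2.2

theorem mem_of_mem_bonds {Λ : Finset (Site d)} {e : Sym2 (Site d)} (he : e ∈ bonds Λ)
    {x : Site d} (hx : x ∈ e) : x ∈ Λ :=
  Finset.mem_sym2_iff.1 (Finset.mem_filter.1 he).1 x hx

theorem abs_spin_le_one {Λ : Finset (Site d)} (σ : Config Λ) (x : Site d) : |spin σ x| ≤ 1 := by
  unfold spin
  split_ifs with hx
  · rcases Int.units_eq_one_or (σ ⟨x, hx⟩) with h | h <;> simp [h]
  · simp

theorem abs_mul_spin_le_one {Λ : Finset (Site d)} (σ : Config Λ) (e : Sym2 (Site d)) :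
    |(e.map (spin σ)).mul| ≤ 1 := by
  induction e with | _ a b
  simp only [Sym2.map_mk, Sym2.mul_mk, abs_mul]
  exact mul_le_one₀ (abs_spin_le_one σ a) (abs_nonneg _) (abs_spin_le_one σ b)

theorem partition2_eq_sum_prod (Λ : Finset (Site d)) (β lam : ℝ) (J : Sym2 (Site d) → ℝ)
    (h b : Site d → ℝ) :
    partition2 Λ β lam J h b =
      ∑ p : Config Λ × Config Λ, Real.exp (-β * hamiltonian2 Λ J h b lam p.1 p.2) := by
  rw [Fintype.sum_prod_type]
  rfl

theorem partition2_pos (Λ : Finset (Site d)) (β lam : ℝ) (J : Sym2 (Site d) → ℝ)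
    (h b : Site d → ℝ) : 0 < partition2 Λ β lam J h b := by
  rw [partition2_eq_sum_prod]
  exact Finset.sum_pos (fun _ _ => Real.exp_pos _) Finset.univ_nonempty

/-- The logarithm of the two-replica partition function. -/
noncomputable def logPartition2 (Λ : Finset (Site d)) (β lam : ℝ) (J : Sym2 (Site d) → ℝ)
    (h b : Site d → ℝ) : ℝ :=
  Real.log (partition2 Λ β lam J h b)

theorem hamiltonian_congr {Λ : Finset (Site d)} {J J' : Sym2 (Site d) → ℝ} {h h' : Site d → ℝ}
    (hJ : ∀ e ∈ bonds Λ, J e = J' e) (hh : ∀ x ∈ Λ, h x = h' x) (σ : Config Λ) :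
    hamiltonian Λ J h 0 σ = hamiltonian Λ J' h' 0 σ := by
  simp only [hamiltonian, Pi.zero_apply, mul_zero, Finset.sum_const_zero]
  have h1 : ∑ e ∈ bonds Λ, J e * (e.map (spin σ)).mul =
      ∑ e ∈ bonds Λ, J' e * (e.map (spin σ)).mul :=
    Finset.sum_congr rfl fun e he => by rw [hJ e he]
  have h2 : ∑ x ∈ Λ, h x * spin σ x = ∑ x ∈ Λ, h' x * spin σ x :=
    Finset.sum_congr rfl fun x hx => by rw [hh x hx]
  rw [h1, h2]

/-- With open boundary the energy reads only the disorder inside the region. Independence over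
disjoint regions and the passage to `DisorderIndex` both rest on this locality. -/
theorem logPartition2_congr {Λ : Finset (Site d)} (β lam : ℝ) {J J' : Sym2 (Site d) → ℝ}
    {h h' : Site d → ℝ} (hJ : ∀ e ∈ bonds Λ, J e = J' e) (hh : ∀ x ∈ Λ, h x = h' x) :
    logPartition2 Λ β lam J h 0 = logPartition2 Λ β lam J' h' 0 := by
  simp only [logPartition2, partition2, hamiltonian2, hamiltonian_congr hJ hh]

theorem abs_hamiltonian_boundary_sub_le {Λ : Finset (Site d)} (J : Sym2 (Site d) → ℝ)
    (h b : Site d → ℝ) (hb : ∀ u ∈ boundary Λ, |b u| ≤ 1) (σ : Config Λ) :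
    |hamiltonian Λ J h b σ - hamiltonian Λ J h 0 σ| ≤ ∑ p ∈ boundaryBonds Λ, |J s(p.1, p.2)| := by
  have : hamiltonian Λ J h b σ - hamiltonian Λ J h 0 σ =
      - ∑ p ∈ boundaryBonds Λ, J s(p.1, p.2) * spin σ p.1 * b p.2 := by
    simp only [hamiltonian, Pi.zero_apply, mul_zero, Finset.sum_const_zero]
    ring
  rw [this, abs_neg]
  refine (Finset.abs_sum_le_sum_abs _ _).trans (Finset.sum_le_sum fun p hp => ?_)
  have hb' := hb p.2 (Finset.mem_product.1 (Finset.mem_filter.1 hp).1).2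
  rw [abs_mul, abs_mul, mul_assoc]
  exact mul_le_of_le_one_right (abs_nonneg _)
    (mul_le_one₀ (abs_spin_le_one σ _) (abs_nonneg _) hb')

/-- Changing the boundary condition costs at most the total strength of the boundary bonds. -/
theorem abs_logPartition2_boundary_sub_le {Λ : Finset (Site d)} {β : ℝ} (hβ : 0 ≤ β) (lam : ℝ)
    (J : Sym2 (Site d) → ℝ) (h b : Site d → ℝ) (hb : ∀ u ∈ boundary Λ, |b u| ≤ 1) :
    |logPartition2 Λ β lam J h b - logPartition2 Λ β lam J h 0| ≤
      2 * β * ∑ p ∈ boundaryBonds Λ, |J s(p.1, p.2)| := by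
  simp only [logPartition2, partition2_eq_sum_prod]
  refine abs_log_sum_exp_sub_le _ _ _ fun p => ?_
  rw [← mul_sub, abs_mul, abs_neg, abs_of_nonneg hβ, mul_comm 2 β, mul_assoc]
  refine mul_le_mul_of_nonneg_left ?_ hβ
  have : hamiltonian2 Λ J h b lam p.1 p.2 - hamiltonian2 Λ J h 0 lam p.1 p.2 =
      (hamiltonian Λ J h b p.1 - hamiltonian Λ J h 0 p.1) +
        (hamiltonian Λ J h b p.2 - hamiltonian Λ J h 0 p.2) := by
    simp only [hamiltonian2]; ring
  rw [this, two_mul]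
  exact (abs_add_le _ _).trans (add_le_add (abs_hamiltonian_boundary_sub_le J h b hb _)
    (abs_hamiltonian_boundary_sub_le J h b hb _))

theorem abs_hamiltonian_le {Λ : Finset (Site d)} (J : Sym2 (Site d) → ℝ)
    (h : Site d → ℝ) (σ : Config Λ) :
    |hamiltonian Λ J h 0 σ| ≤ ∑ e ∈ bonds Λ, |J e| + ∑ x ∈ Λ, |h x| := by
  simp only [hamiltonian, Pi.zero_apply, mul_zero, Finset.sum_const_zero, sub_zero]
  refine (abs_sub _ _).trans (add_le_add ?_ ?_)
  · rw [abs_neg]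
    refine (Finset.abs_sum_le_sum_abs _ _).trans (Finset.sum_le_sum fun e _ => ?_)
    rw [abs_mul]
    exact mul_le_of_le_one_right (abs_nonneg _) (abs_mul_spin_le_one σ e)
  · refine (Finset.abs_sum_le_sum_abs _ _).trans (Finset.sum_le_sum fun x _ => ?_)
    rw [abs_mul]
    exact mul_le_of_le_one_right (abs_nonneg _) (abs_spin_le_one σ x)

theorem abs_sum_spin_mul_spin_le {Λ : Finset (Site d)} (σ₁ σ₂ : Config Λ) :
    |∑ x ∈ Λ, spin σ₁ x * spin σ₂ x| ≤ Λ.card := by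
  refine (Finset.abs_sum_le_sum_abs _ _).trans ?_
  refine (Finset.sum_le_sum fun x _ => (?_ : _ ≤ (1 : ℝ))).trans (by simp)
  rw [abs_mul]
  exact mul_le_one₀ (abs_spin_le_one σ₁ x) (abs_nonneg _) (abs_spin_le_one σ₂ x)

/-- Comparison with the zero Hamiltonian, whose partition function counts pairs of configurations.
The bound is linear in the disorder, so finite first moments make `logPartition2` integrable. -/
theorem abs_logPartition2_le {Λ : Finset (Site d)} {β : ℝ} (hβ : 0 ≤ β) (lam : ℝ)
    (J : Sym2 (Site d) → ℝ) (h : Site d → ℝ) :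
    |logPartition2 Λ β lam J h 0| ≤ 2 * β * (∑ e ∈ bonds Λ, |J e| + ∑ x ∈ Λ, |h x|) +
      (β * |lam| * Λ.card + Real.log (Fintype.card (Config Λ × Config Λ))) := by
  have key := abs_log_sum_exp_sub_le
    (fun p : Config Λ × Config Λ => -β * hamiltonian2 Λ J h 0 lam p.1 p.2) (fun _ => 0)
    (2 * β * (∑ e ∈ bonds Λ, |J e| + ∑ x ∈ Λ, |h x|) + β * |lam| * Λ.card) fun p => ?_
  · simp only [Real.exp_zero, Finset.sum_const, nsmul_eq_mul, mul_one, Finset.card_univ,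
      ← partition2_eq_sum_prod] at key
    have h2 : 0 ≤ Real.log (Fintype.card (Config Λ × Config Λ)) := by
      refine Real.log_nonneg ?_
      exact_mod_cast Fintype.card_pos (α := Config Λ × Config Λ)
    unfold logPartition2
    rw [abs_le] at key ⊢
    constructor <;> linarith [key.1, key.2]
  · rw [sub_zero, abs_mul, abs_neg, abs_of_nonneg hβ, mul_comm 2 β, mul_assoc, mul_assoc, ← mul_add]
    refine mul_le_mul_of_nonneg_left ?_ hβ
    unfold hamiltonian2
    refine (abs_sub _ _).trans (add_le_add ?_ ?_)
    · rw [two_mul]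
      exact (abs_add_le _ _).trans (add_le_add (abs_hamiltonian_le J h _)
        (abs_hamiltonian_le J h _))
    · rw [abs_mul]
      exact mul_le_mul_of_nonneg_left (abs_sum_spin_mul_spin_le _ _) (abs_nonneg _)

theorem logPartition2_empty (β lam : ℝ) (J : Sym2 (Site d) → ℝ) (h : Site d → ℝ) :
    logPartition2 ∅ β lam J h 0 = 0 := by
  have hb : bonds (∅ : Finset (Site d)) = ∅ := by simp [bonds]
  simp [logPartition2, partition2, hamiltonian2, hamiltonian, hb]

/-- Configurations on a disjoint union. -/
noncomputable def configUnionEquiv {A B : Finset (Site d)} (hAB : Disjoint A B) :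
    Config (A ∪ B) ≃ Config A × Config B :=
  ((Equiv.Finset.union A B hAB).arrowCongr (Equiv.refl ℤˣ)).symm.trans
    (Equiv.sumArrowEquivProdArrow _ _ _)

theorem spin_configUnionEquiv_fst {A B : Finset (Site d)} (hAB : Disjoint A B)
    (σ : Config (A ∪ B)) {x : Site d} (hx : x ∈ A) :
    spin (configUnionEquiv hAB σ).1 x = spin σ x := by
  simp only [spin, hx, Finset.mem_union_left B hx, dif_pos]
  rfl

theorem spin_configUnionEquiv_snd {A B : Finset (Site d)} (hAB : Disjoint A B)
    (σ : Config (A ∪ B)) {x : Site d} (hx : x ∈ B) :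
    spin (configUnionEquiv hAB σ).2 x = spin σ x := by
  simp only [spin, hx, Finset.mem_union_right A hx, dif_pos]
  rfl

theorem mul_spin_congr {Λ Λ' A : Finset (Site d)} {σ : Config Λ} {τ : Config Λ'}
    (hστ : ∀ x ∈ A, spin σ x = spin τ x) {e : Sym2 (Site d)} (he : e ∈ bonds A) :
    (e.map (spin σ)).mul = (e.map (spin τ)).mul := by
  rw [Sym2.map_congr fun x hx => hστ x (mem_of_mem_bonds he hx)]

theorem disjoint_bonds {A B : Finset (Site d)} (hAB : Disjoint A B) :
    Disjoint (bonds A) (bonds B) := by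
  refine Finset.disjoint_left.2 fun e heA heB => ?_
  induction e with | _ a b
  exact Finset.disjoint_left.1 hAB (mem_bonds.1 heA).1.1 (mem_bonds.1 heB).1.1

theorem bonds_union_subset {A B : Finset (Site d)} : bonds A ∪ bonds B ⊆ bonds (A ∪ B) := by
  intro e
  induction e with | _ a b
  simp only [Finset.mem_union, mem_bonds]
  tauto

/-- A bond of the union that lies in neither part has exactly one end in `A`; orienting it from that
end embeds it in `boundaryBonds A`. Only an inequality holds, since `A` may also have bonds leaving
the union. -/
theorem sum_abs_bonds_sdiff_le {A B : Finset (Site d)}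
    (J : Sym2 (Site d) → ℝ) :
    ∑ e ∈ bonds (A ∪ B) \ (bonds A ∪ bonds B), |J e| ≤
      ∑ p ∈ boundaryBonds A, |J s(p.1, p.2)| := by
  have hinj : Set.InjOn (fun p : Site d × Site d => s(p.1, p.2)) (boundaryBonds A) := by
    rintro ⟨a, b⟩ hp ⟨a', b'⟩ hq hpq
    have h1 := mem_boundaryBonds.1 hp
    have h2 := mem_boundaryBonds.1 hq
    rcases Sym2.eq_iff.1 hpq with ⟨h, h'⟩ | ⟨h, h'⟩
    · exact Prod.ext h h'
    · simp only at h h' h1 h2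
      exact absurd (h ▸ h1.1) h2.2.1
  rw [← Finset.sum_image (f := fun e => |J e|) hinj]
  refine Finset.sum_le_sum_of_subset_of_nonneg ?_ fun _ _ _ => abs_nonneg _
  intro e
  induction e with | _ a b
  simp only [Finset.mem_sdiff, Finset.mem_union, mem_bonds, Finset.mem_image, mem_boundaryBonds]
  rintro ⟨⟨⟨ha, hb⟩, hab⟩, hn⟩
  by_cases haA : a ∈ A
  · exact ⟨(a, b), ⟨haA, fun hbA => hn (Or.inl ⟨⟨haA, hbA⟩, hab⟩), hab⟩, rfl⟩
  · have haB := ha.resolve_left haA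
    refine ⟨(b, a), ⟨?_, haA, hab.symm⟩, Sym2.eq_swap⟩
    exact hb.resolve_right fun hbB => hn (Or.inr ⟨⟨haB, hbB⟩, hab⟩)

/-- Fields and interior bonds split exactly; only the bonds across the cut remain, each weighted by
a spin product of modulus at most one. -/
theorem abs_hamiltonian_union_sub_le {A B : Finset (Site d)} (hAB : Disjoint A B)
    (J : Sym2 (Site d) → ℝ) (h : Site d → ℝ) (σ : Config (A ∪ B)) :
    |hamiltonian (A ∪ B) J h 0 σ - (hamiltonian A J h 0 (configUnionEquiv hAB σ).1 +
      hamiltonian B J h 0 (configUnionEquiv hAB σ).2)| ≤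
      ∑ p ∈ boundaryBonds A, |J s(p.1, p.2)| := by
  have hA : ∀ x ∈ A, spin (configUnionEquiv hAB σ).1 x = spin σ x := fun x hx =>
    spin_configUnionEquiv_fst hAB σ hx
  have hB : ∀ x ∈ B, spin (configUnionEquiv hAB σ).2 x = spin σ x := fun x hx =>
    spin_configUnionEquiv_snd hAB σ hx
  have : hamiltonian (A ∪ B) J h 0 σ - (hamiltonian A J h 0 (configUnionEquiv hAB σ).1 +
      hamiltonian B J h 0 (configUnionEquiv hAB σ).2) =
      - ∑ e ∈ bonds (A ∪ B) \ (bonds A ∪ bonds B), J e * (e.map (spin σ)).mul := by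
    simp only [hamiltonian, Pi.zero_apply, mul_zero, Finset.sum_const_zero, sub_zero]
    have h1 : ∑ e ∈ bonds A, J e * (e.map (spin (configUnionEquiv hAB σ).1)).mul =
        ∑ e ∈ bonds A, J e * (e.map (spin σ)).mul :=
      Finset.sum_congr rfl fun e he => by rw [mul_spin_congr hA he]
    have h2 : ∑ e ∈ bonds B, J e * (e.map (spin (configUnionEquiv hAB σ).2)).mul =
        ∑ e ∈ bonds B, J e * (e.map (spin σ)).mul :=
      Finset.sum_congr rfl fun e he => by rw [mul_spin_congr hB he]
    have h3 : ∑ x ∈ A, h x * spin (configUnionEquiv hAB σ).1 x = ∑ x ∈ A, h x * spin σ x :=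
      Finset.sum_congr rfl fun x hx => by rw [hA x hx]
    have h4 : ∑ x ∈ B, h x * spin (configUnionEquiv hAB σ).2 x = ∑ x ∈ B, h x * spin σ x :=
      Finset.sum_congr rfl fun x hx => by rw [hB x hx]
    rw [← Finset.sum_sdiff (bonds_union_subset (A := A) (B := B)),
      Finset.sum_union (disjoint_bonds hAB), Finset.sum_union hAB, h1, h2, h3, h4]
    ring
  rw [this, abs_neg]
  refine le_trans ?_ (sum_abs_bonds_sdiff_le (B := B) J)
  refine (Finset.abs_sum_le_sum_abs _ _).trans (Finset.sum_le_sum fun e _ => ?_)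
  rw [abs_mul]
  exact mul_le_of_le_one_right (abs_nonneg _) (abs_mul_spin_le_one σ e)

/-- The logarithm of the partition function is additive over disjoint regions, up to the total
strength of the bonds between them. -/
theorem abs_logPartition2_union_sub_le {A B : Finset (Site d)} (hAB : Disjoint A B) {β : ℝ}
    (hβ : 0 ≤ β) (lam : ℝ) (J : Sym2 (Site d) → ℝ) (h : Site d → ℝ) :
    |logPartition2 (A ∪ B) β lam J h 0 -
      (logPartition2 A β lam J h 0 + logPartition2 B β lam J h 0)| ≤
      2 * β * ∑ p ∈ boundaryBonds A, |J s(p.1, p.2)| := by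
  -- Reindexing the product by pairs of configurations on the union puts both sides in log-sum-exp
  -- form over one index set. The exponents then differ by one cut per replica, hence the factor
  -- two; the replica coupling is a sum over sites and splits without error.
  have hprod : partition2 A β lam J h 0 * partition2 B β lam J h 0 =
      ∑ p : Config (A ∪ B) × Config (A ∪ B), Real.exp (-β *
        (hamiltonian2 A J h 0 lam (configUnionEquiv hAB p.1).1 (configUnionEquiv hAB p.2).1 +
         hamiltonian2 B J h 0 lam (configUnionEquiv hAB p.1).2 (configUnionEquiv hAB p.2).2)) := by
    rw [partition2_eq_sum_prod, partition2_eq_sum_prod, Finset.sum_mul_sum, ← Finset.sum_product',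
      Finset.univ_product_univ]
    refine (Fintype.sum_equiv (((configUnionEquiv hAB).prodCongr (configUnionEquiv hAB)).trans
      (Equiv.prodProdProdComm _ _ _ _)) _ _ fun p => ?_).symm
    rw [← Real.exp_add, ← mul_add]
    rfl
  unfold logPartition2
  rw [← Real.log_mul (partition2_pos _ _ _ _ _ _).ne' (partition2_pos _ _ _ _ _ _).ne', hprod,
    partition2_eq_sum_prod]
  refine abs_log_sum_exp_sub_le _ _ _ fun p => ?_
  rw [← mul_sub, abs_mul, abs_neg, abs_of_nonneg hβ, mul_comm 2 β, mul_assoc]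
  refine mul_le_mul_of_nonneg_left ?_ hβ
  have h1 := abs_hamiltonian_union_sub_le hAB J h p.1
  have h2 := abs_hamiltonian_union_sub_le hAB J h p.2
  have hs : ∑ x ∈ A ∪ B, spin p.1 x * spin p.2 x =
      ∑ x ∈ A, spin (configUnionEquiv hAB p.1).1 x * spin (configUnionEquiv hAB p.2).1 x +
      ∑ x ∈ B, spin (configUnionEquiv hAB p.1).2 x * spin (configUnionEquiv hAB p.2).2 x := by
    rw [Finset.sum_union hAB]
    congr 1
    · exact Finset.sum_congr rfl fun x hx => by
        rw [spin_configUnionEquiv_fst hAB _ hx, spin_configUnionEquiv_fst hAB _ hx]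
    · exact Finset.sum_congr rfl fun x hx => by
        rw [spin_configUnionEquiv_snd hAB _ hx, spin_configUnionEquiv_snd hAB _ hx]
  simp only [hamiltonian2, hs]
  refine le_trans (le_of_eq ?_) ((abs_add_le _ _).trans ((add_le_add h1 h2).trans_eq
    (two_mul _).symm))
  congr 1
  ring

/-- Approximate additivity over finite families of disjoint regions. -/
theorem abs_logPartition2_biUnion_sub_le {ι : Type*} {s : Finset ι}
    {A : ι → Finset (Site d)} (hA : Set.PairwiseDisjoint (s : Set ι) A) {β : ℝ}
    (hβ : 0 ≤ β) (lam : ℝ) (J : Sym2 (Site d) → ℝ) (h : Site d → ℝ) :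
    |logPartition2 (s.biUnion A) β lam J h 0 - ∑ i ∈ s, logPartition2 (A i) β lam J h 0| ≤
      ∑ i ∈ s, 2 * β * ∑ p ∈ boundaryBonds (A i), |J s(p.1, p.2)| := by
  classical
  induction s using Finset.induction_on with
  | empty => simp [logPartition2_empty]
  | insert i s hi ih =>
    have hd : Disjoint (A i) (s.biUnion A) := by
      rw [Finset.disjoint_biUnion_right]
      intro j hj
      refine hA (by simp) (by simp [hj]) ?_
      rintro rfl
      exact hi hj
    have h1 := abs_logPartition2_union_sub_le hd hβ lam J h
    have h2 := ih (hA.subset (by simp))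
    rw [Finset.biUnion_insert, Finset.sum_insert hi, Finset.sum_insert hi]
    refine le_trans (le_of_eq ?_) ((abs_add_le _ _).trans (add_le_add h1 h2))
    congr 1
    ring

/-- The translate of a region. -/
def translate (v : Site d) (Λ : Finset (Site d)) : Finset (Site d) :=
  Λ.map (Equiv.addRight v).toEmbedding

theorem add_mem_translate {v x : Site d} {Λ : Finset (Site d)} :
    x + v ∈ translate v Λ ↔ x ∈ Λ := by
  simp [translate]

theorem mem_translate {v x : Site d} {Λ : Finset (Site d)} :
    x ∈ translate v Λ ↔ x - v ∈ Λ := by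
  rw [← add_mem_translate (v := v) (x := x - v), sub_add_cancel]

theorem sum_translate (v : Site d) (Λ : Finset (Site d)) (f : Site d → ℝ) :
    ∑ x ∈ translate v Λ, f x = ∑ x ∈ Λ, f (x + v) :=
  Finset.sum_map _ _ _

theorem adj_add_right {v x y : Site d} :
    (lattice d).Adj (x + v) (y + v) ↔ (lattice d).Adj x y := by
  simp [lattice]

theorem map_add_mem_edgeSet {v : Site d} {e : Sym2 (Site d)} :
    e.map (· + v) ∈ (lattice d).edgeSet ↔ e ∈ (lattice d).edgeSet := by
  induction e with | _ a b
  exact adj_add_right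

theorem bonds_translate (v : Site d) (Λ : Finset (Site d)) :
    bonds (translate v Λ) =
      (bonds Λ).map (Function.Embedding.sym2Map (Equiv.addRight v).toEmbedding) := by
  rw [bonds, translate, Finset.sym2_map, Finset.filter_map]
  congr 1
  exact Finset.filter_congr fun e _ => map_add_mem_edgeSet

/-- Configurations on a translate. -/
def configTranslateEquiv (v : Site d) (Λ : Finset (Site d)) :
    Config (translate v Λ) ≃ Config Λ :=
  (((Equiv.addRight v).subtypeEquiv fun _ => add_mem_translate.symm).arrowCongr
    (Equiv.refl ℤˣ)).symm

theorem spin_configTranslateEquiv (v : Site d) (Λ : Finset (Site d))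
    (σ : Config (translate v Λ)) (x : Site d) :
    spin (configTranslateEquiv v Λ σ) x = spin σ (x + v) := by
  simp only [spin, add_mem_translate]
  rfl

theorem hamiltonian_translate (v : Site d) (Λ : Finset (Site d)) (J : Sym2 (Site d) → ℝ)
    (h : Site d → ℝ) (σ : Config (translate v Λ)) :
    hamiltonian (translate v Λ) J h 0 σ =
      hamiltonian Λ (fun e => J (e.map (· + v))) (fun x => h (x + v)) 0
        (configTranslateEquiv v Λ σ) := by
  have hσ : spin (configTranslateEquiv v Λ σ) = spin σ ∘ (· + v) :=
    funext fun x => spin_configTranslateEquiv v Λ σ x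
  simp only [hamiltonian, Pi.zero_apply, mul_zero, Finset.sum_const_zero, bonds_translate,
    Finset.sum_map, hσ, sum_translate, Function.comp_apply, sub_zero]
  congr 2
  refine Finset.sum_congr rfl fun e _ => ?_
  induction e with | _ a b
  rfl

theorem logPartition2_translate (v : Site d) (Λ : Finset (Site d)) (β lam : ℝ)
    (J : Sym2 (Site d) → ℝ) (h : Site d → ℝ) :
    logPartition2 (translate v Λ) β lam J h 0 =
      logPartition2 Λ β lam (fun e => J (e.map (· + v))) (fun x => h (x + v)) 0 := by
  unfold logPartition2
  rw [partition2_eq_sum_prod, partition2_eq_sum_prod]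
  congr 1
  refine Fintype.sum_equiv ((configTranslateEquiv v Λ).prodCongr (configTranslateEquiv v Λ)) _ _
    fun p => ?_
  simp only [hamiltonian2, hamiltonian_translate, Equiv.prodCongr_apply, Prod.map_fst,
    Prod.map_snd, spin_configTranslateEquiv]
  rw [sum_translate]

theorem card_boundaryBonds_translate_le (v : Site d) (Λ : Finset (Site d)) :
    (boundaryBonds (translate v Λ)).card ≤ (boundaryBonds Λ).card := by
  refine Finset.card_le_card_of_injOn (fun p => (p.1 - v, p.2 - v)) (fun p hp => ?_) ?_
  · have := mem_boundaryBonds.1 hp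
    rw [mem_translate, mem_translate] at this
    refine mem_boundaryBonds.2 ⟨this.1, this.2.1, ?_⟩
    rw [← adj_add_right (v := v)]
    simpa using this.2.2
  · intro p _ q _ hpq
    simp only [Prod.mk.injEq, sub_left_inj] at hpq
    exact Prod.ext hpq.1 hpq.2

/-- For each pair of configurations the exponent is affine in `lam`. -/
theorem convexOn_logPartition2 (Λ : Finset (Site d)) (β : ℝ) (J : Sym2 (Site d) → ℝ)
    (h b : Site d → ℝ) :
    ConvexOn ℝ Set.univ fun lam => logPartition2 Λ β lam J h b := by
  have := convexOn_log_sum_exp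
    (fun p : Config Λ × Config Λ => -β * (hamiltonian Λ J h b p.1 + hamiltonian Λ J h b p.2))
    (fun p => β * ∑ x ∈ Λ, spin p.1 x * spin p.2 x)
  convert this using 2 with lam
  unfold logPartition2
  rw [partition2_eq_sum_prod]
  congr 1
  refine Finset.sum_congr rfl fun p _ => ?_
  congr 1
  unfold hamiltonian2
  ring

end Deterministic

/-! ### Boxes, their surfaces and their tiling by blocks -/

section Geometry

variable {d : ℕ}

theorem mem_box {L : ℕ} {x : Site d} : x ∈ box d L ↔ ∀ i, 1 ≤ x i ∧ x i ≤ L := by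
  simp [box]

theorem card_box (d L : ℕ) : (box d L).card = L ^ d := by
  simp [box]

/-- The boundary bonds of a box are few: each starts in the outermost layer of the box. -/
theorem card_boundaryBonds_box_le (d L : ℕ) :
    ((boundaryBonds (box d L)).card : ℝ) ≤ 3 ^ d * ((L : ℝ) ^ d - ((L - 2 : ℕ) : ℝ) ^ d) := by
  -- A site here has its whole sup-norm unit ball inside the box, so no boundary bond starts at it;
  -- elsewhere the `3 ^ d` points of that ball bound the number of partners. For `L < 2` the
  -- natural-number difference `L - 2` is zero, matching the empty interval.
  set inner : Finset (Site d) := Fintype.piFinset fun _ => Finset.Icc (2 : ℤ) ((L : ℤ) - 1)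
  have hsub : inner ⊆ box d L := by
    intro x hx
    simp only [inner, Fintype.mem_piFinset, Finset.mem_Icc] at hx
    exact mem_box.2 fun i => by have := hx i; omega
  have hinner : inner.card = (L - 2) ^ d := by
    simp only [inner, Fintype.card_piFinset, Int.card_Icc, Finset.prod_const, Finset.card_univ,
      Fintype.card_fin]
    congr 1
    omega
  have hcard : ((box d L \ inner).card : ℝ) = (L : ℝ) ^ d - ((L - 2 : ℕ) : ℝ) ^ d := by
    rw [Finset.card_sdiff_of_subset hsub, Nat.cast_sub (Finset.card_le_card hsub), card_box, hinner]
    push_cast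
    rfl
  have hle : (boundaryBonds (box d L)).card ≤ (box d L \ inner).card * 3 ^ d := by
    have hsub' : boundaryBonds (box d L) ⊆ (box d L \ inner).biUnion fun x =>
        (Fintype.piFinset fun i => Finset.Icc (x i - 1) (x i + 1)).map
          ⟨Prod.mk x, Prod.mk_right_injective x⟩ := by
      rintro ⟨x, u⟩ hp
      obtain ⟨hx, hu, hxu⟩ := mem_boundaryBonds.1 hp
      simp only at hx hu hxu
      have hxu' : ∀ i, |x i - u i| ≤ 1 := fun i => by
        have h1 : |x i - u i| ≤ ∑ j, |x j - u j| :=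
          Finset.single_le_sum (f := fun j => |x j - u j|) (fun j _ => abs_nonneg _)
            (Finset.mem_univ i)
        exact h1.trans_eq hxu
      simp only [Finset.mem_biUnion, Finset.mem_sdiff, Finset.mem_map, Fintype.mem_piFinset,
        Finset.mem_Icc, Function.Embedding.coeFn_mk, Prod.mk.injEq]
      refine ⟨x, ⟨hx, fun hxi => hu ?_⟩, u, fun i => ?_, rfl, rfl⟩
      · simp only [inner, Fintype.mem_piFinset, Finset.mem_Icc] at hxi
        refine mem_box.2 fun i => ?_
        have h1 := hxi i
        have h2 := abs_le.1 (hxu' i)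
        omega
      · have h2 := abs_le.1 (hxu' i)
        omega
    refine (Finset.card_le_card hsub').trans (Finset.card_biUnion_le_card_mul _ _ _ fun x _ => ?_)
    rw [Finset.card_map, Fintype.card_piFinset]
    refine (Finset.prod_le_pow_card _ _ 3 fun i _ => ?_).trans (by simp)
    rw [Int.card_Icc]
    omega
  calc ((boundaryBonds (box d L)).card : ℝ) ≤ ((box d L \ inner).card * 3 ^ d : ℕ) := by
        exact_mod_cast hle
    _ = _ := by push_cast; rw [hcard]; ring

theorem tendsto_card_boundaryBonds_box_div (d : ℕ) :
    Tendsto (fun L : ℕ => ((boundaryBonds (box d L)).card : ℝ) / (L : ℝ) ^ d) atTop (𝓝 0) := by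
  have h1 : Tendsto (fun L : ℕ => (3 : ℝ) ^ d * (1 - (1 - 2 / (L : ℝ)) ^ d)) atTop
      (𝓝 (3 ^ d * (1 - (1 - 0) ^ d))) :=
    (((tendsto_const_nhds.sub (tendsto_const_div_atTop_nhds_zero_nat 2)).pow d).const_sub 1).const_mul _
  rw [sub_zero, one_pow, sub_self, mul_zero] at h1
  refine squeeze_zero' (Eventually.of_forall fun L => by positivity) ?_ h1
  filter_upwards [eventually_ge_atTop 2] with L hL
  have hL0 : (0 : ℝ) < L := by exact_mod_cast (by omega : 0 < L)
  rw [div_le_iff₀ (by positivity)]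
  refine (card_boundaryBonds_box_le d L).trans_eq ?_
  rw [Nat.cast_sub hL, mul_assoc, sub_mul, one_mul, ← mul_pow]
  congr 4
  field_simp
  norm_num

/-- The translates of a box of side `M` that tile the lattice. -/
noncomputable def block (M : ℕ) (v : Site d) : Finset (Site d) :=
  translate (fun i => (M : ℤ) * v i) (box d M)

theorem mem_block {M : ℕ} {v x : Site d} :
    x ∈ block M v ↔ ∀ i, (M : ℤ) * v i + 1 ≤ x i ∧ x i ≤ (M : ℤ) * v i + M := by
  rw [block, mem_translate, mem_box]
  refine forall_congr' fun i => ?_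
  rw [Pi.sub_apply]
  constructor <;> rintro ⟨h1, h2⟩ <;> constructor <;> linarith

theorem card_block (M : ℕ) (v : Site d) : (block M v).card = M ^ d := by
  rw [block, translate, Finset.card_map, card_box]

theorem disjoint_block {M : ℕ} {v w : Site d} (hvw : v ≠ w) : Disjoint (block M v) (block M w) := by
  refine Finset.disjoint_left.2 fun x hv hw => hvw (funext fun i => ?_)
  have h1 := mem_block.1 hv i
  have h2 := mem_block.1 hw i
  have hM : (0 : ℤ) < M := by omega
  have h3 : (M : ℤ) * v i < M * (w i + 1) := by rw [mul_add]; omega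
  have h4 : (M : ℤ) * w i < M * (v i + 1) := by rw [mul_add]; omega
  have h5 := lt_of_mul_lt_mul_left h3 hM.le
  have h6 := lt_of_mul_lt_mul_left h4 hM.le
  omega

/-- The indices of the blocks of side `M` in the box of side `k * M`. -/
noncomputable def blockIndices (d k : ℕ) : Finset (Site d) :=
  Fintype.piFinset fun _ => Finset.Ico (0 : ℤ) k

theorem card_blockIndices (d k : ℕ) : (blockIndices d k).card = k ^ d := by
  simp [blockIndices]

theorem biUnion_block_subset {M k L : ℕ} (hk : k * M ≤ L) :
    (blockIndices d k).biUnion (block M) ⊆ box d L := by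
  refine Finset.biUnion_subset.2 fun v hv x hx => mem_box.2 fun i => ?_
  have h1 := mem_block.1 hx i
  simp only [blockIndices, Fintype.mem_piFinset, Finset.mem_Ico] at hv
  have h2 := hv i
  have h3 : (0 : ℤ) ≤ M * v i := mul_nonneg (by omega) h2.1
  have h4 : (M : ℤ) * (v i + 1) ≤ M * k := mul_le_mul_of_nonneg_left (by omega) (by omega)
  have h5 : (M : ℤ) * k ≤ L := by rw [mul_comm]; exact_mod_cast hk
  rw [mul_add] at h4
  omega

theorem card_biUnion_block (d M k : ℕ) :
    ((blockIndices d k).biUnion (block M)).card = k ^ d * M ^ d := by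
  rw [Finset.card_biUnion fun v _ w _ hvw => disjoint_block hvw,
    Finset.sum_congr rfl fun v _ => card_block M v, Finset.sum_const, card_blockIndices,
    smul_eq_mul]

/-- The sites of the box of side `L` outside the blocks of side `M`. -/
noncomputable def remainder (d M k L : ℕ) : Finset (Site d) :=
  box d L \ (blockIndices d k).biUnion (block M)

theorem card_remainder {M k L : ℕ} (hk : k * M ≤ L) :
    ((remainder d M k L).card : ℝ) = (L : ℝ) ^ d - (k : ℝ) ^ d * (M : ℝ) ^ d := by
  rw [remainder, Finset.card_sdiff_of_subset (biUnion_block_subset hk),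
    Nat.cast_sub (Finset.card_le_card (biUnion_block_subset hk)), card_box, card_biUnion_block]
  push_cast
  rfl

/-- The free energy of a box is that of its blocks of side `M`, up to the strength of the bonds
between the blocks and the contribution of the remaining sites. -/
theorem abs_logPartition2_box_sub_le {M k L : ℕ} (hk : k * M ≤ L) {β : ℝ} (hβ : 0 ≤ β) (lam : ℝ)
    (J : Sym2 (Site d) → ℝ) (h : Site d → ℝ) :
    |logPartition2 (box d L) β lam J h 0 -
        ∑ v ∈ blockIndices d k, logPartition2 (block M v) β lam J h 0| ≤
      ∑ v ∈ blockIndices d k, 2 * β * ∑ p ∈ boundaryBonds (block M v), |J s(p.1, p.2)| +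
      ∑ x ∈ remainder d M k L, (2 * β * ∑ p ∈ boundaryBonds {x}, |J s(p.1, p.2)| +
        |logPartition2 {x} β lam J h 0|) := by
  -- Leftover sites enter as one-point regions alongside the blocks, so a single use of approximate
  -- additivity covers the whole box.
  have hdisj : Set.PairwiseDisjoint
      (((blockIndices d k).disjSum (remainder d M k L) : Finset (Site d ⊕ Site d)) :
        Set (Site d ⊕ Site d)) (Sum.elim (block M) fun x => {x}) := by
    rintro (v | x) hv (w | y) hw hvw
    · exact disjoint_block fun h => hvw (by rw [h])
    · refine Finset.disjoint_singleton_right.2 fun hy => ?_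
      have hw := (Finset.mem_sdiff.1 (Finset.inr_mem_disjSum.1 (Finset.mem_coe.1 hw))).2
      exact hw (Finset.mem_biUnion.2 ⟨v, Finset.inl_mem_disjSum.1 (Finset.mem_coe.1 hv), hy⟩)
    · refine Finset.disjoint_singleton_left.2 fun hx => ?_
      have hv := (Finset.mem_sdiff.1 (Finset.inr_mem_disjSum.1 (Finset.mem_coe.1 hv))).2
      exact hv (Finset.mem_biUnion.2 ⟨w, Finset.inl_mem_disjSum.1 (Finset.mem_coe.1 hw), hx⟩)
    · exact Finset.disjoint_singleton.2 fun h => hvw (by rw [h])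
  have hunion : ((blockIndices d k).disjSum (remainder d M k L)).biUnion
      (Sum.elim (block M) fun x => {x}) = box d L := by
    rw [← Finset.union_sdiff_of_subset (biUnion_block_subset hk)]
    ext x
    simp only [Finset.mem_biUnion, Sum.exists, Finset.inl_mem_disjSum, Finset.inr_mem_disjSum,
      Sum.elim_inl, Sum.elim_inr, Finset.mem_union, Finset.mem_singleton, exists_eq_right']
    rfl
  have key := abs_logPartition2_biUnion_sub_le hdisj hβ lam J h
  rw [hunion, Finset.sum_disjSum, Finset.sum_disjSum] at key
  simp only [Sum.elim_inl, Sum.elim_inr] at key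
  rw [Finset.sum_add_distrib]
  have h2 := Finset.abs_sum_le_sum_abs (fun x => logPartition2 {x} β lam J h 0) (remainder d M k L)
  rw [abs_le] at key h2 ⊢
  constructor <;> linarith [key.1, key.2, h2.1, h2.2]

end Geometry

/-! ### Measurability in the disorder -/

section Measurability

variable {d : ℕ} {α : Type*} [MeasurableSpace α] {Λ : Finset (Site d)}
  {J : α → Sym2 (Site d) → ℝ} {h b : α → Site d → ℝ}

theorem measurable_hamiltonian (hJ : ∀ e ∈ (lattice d).edgeSet, Measurable fun a => J a e)
    (hh : ∀ x, Measurable fun a => h a x) (hb : ∀ u ∈ boundary Λ, Measurable fun a => b a u)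
    (σ : Config Λ) : Measurable fun a => hamiltonian Λ (J a) (h a) (b a) σ := by
  unfold hamiltonian
  refine ((Measurable.neg ?_).sub ?_).sub ?_
  · exact Finset.measurable_fun_sum _ fun e he => (hJ e (mem_edgeSet_of_mem_bonds he)).mul_const _
  · refine Finset.measurable_fun_sum _ fun p hp => ?_
    exact ((hJ _ (mem_edgeSet_of_mem_boundaryBonds hp)).mul_const _).mul
      (hb _ (Finset.mem_product.1 (Finset.mem_filter.1 hp).1).2)
  · exact Finset.measurable_fun_sum _ fun x _ => (hh x).mul_const _

theorem measurable_hamiltonian2 (hJ : ∀ e ∈ (lattice d).edgeSet, Measurable fun a => J a e)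
    (hh : ∀ x, Measurable fun a => h a x) (hb : ∀ u ∈ boundary Λ, Measurable fun a => b a u)
    (lam : ℝ) (σ₁ σ₂ : Config Λ) :
    Measurable fun a => hamiltonian2 Λ (J a) (h a) (b a) lam σ₁ σ₂ :=
  ((measurable_hamiltonian hJ hh hb σ₁).add (measurable_hamiltonian hJ hh hb σ₂)).sub_const _

theorem measurable_partition2 (hJ : ∀ e ∈ (lattice d).edgeSet, Measurable fun a => J a e)
    (hh : ∀ x, Measurable fun a => h a x) (hb : ∀ u ∈ boundary Λ, Measurable fun a => b a u)
    (β lam : ℝ) : Measurable fun a => partition2 Λ β lam (J a) (h a) (b a) :=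
  Finset.measurable_fun_sum _ fun σ₁ _ => Finset.measurable_fun_sum _ fun σ₂ _ =>
    ((measurable_hamiltonian2 hJ hh hb lam σ₁ σ₂).const_mul _).exp

theorem measurable_logPartition2 (hJ : ∀ e ∈ (lattice d).edgeSet, Measurable fun a => J a e)
    (hh : ∀ x, Measurable fun a => h a x) (hb : ∀ u ∈ boundary Λ, Measurable fun a => b a u)
    (β lam : ℝ) : Measurable fun a => logPartition2 Λ β lam (J a) (h a) (b a) :=
  (measurable_partition2 hJ hh hb β lam).log

theorem measurable_gibbs2 (hJ : ∀ e ∈ (lattice d).edgeSet, Measurable fun a => J a e)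
    (hh : ∀ x, Measurable fun a => h a x) (hb : ∀ u ∈ boundary Λ, Measurable fun a => b a u)
    (β lam : ℝ) (F : Config Λ → Config Λ → ℝ) :
    Measurable fun a => gibbs2 Λ β lam (J a) (h a) (b a) F :=
  (measurable_partition2 hJ hh hb β lam).inv.mul <|
    Finset.measurable_fun_sum _ fun σ₁ _ => Finset.measurable_fun_sum _ fun σ₂ _ =>
      ((measurable_hamiltonian2 hJ hh hb lam σ₁ σ₂).const_mul _).exp.const_mul _

end Measurability

/-! ### The random disorder: stationarity, independence, integrability -/

/-- The index set of the disorder: nearest-neighbour bonds and sites. -/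
abbrev DisorderIndex (d : ℕ) : Type := (lattice d).edgeSet ⊕ Site d

open Classical in
/-- The couplings encoded in a disorder configuration, extended by zero. -/
noncomputable def couplingOf {d : ℕ} (y : DisorderIndex d → ℝ) (e : Sym2 (Site d)) : ℝ :=
  if he : e ∈ (lattice d).edgeSet then y (Sum.inl ⟨e, he⟩) else 0

/-- The fields encoded in a disorder configuration. -/
def fieldOf {d : ℕ} (y : DisorderIndex d → ℝ) (x : Site d) : ℝ := y (Sum.inr x)

theorem couplingOf_of_mem {d : ℕ} (y : DisorderIndex d → ℝ) {e : Sym2 (Site d)}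
    (he : e ∈ (lattice d).edgeSet) : couplingOf y e = y (Sum.inl ⟨e, he⟩) :=
  dif_pos he

/-- The translation of the disorder indices. -/
def shiftIndex {d : ℕ} (v : Site d) : DisorderIndex d → DisorderIndex d :=
  Sum.map (fun e => ⟨e.1.map (· + v), map_add_mem_edgeSet.2 e.2⟩) (· + v)

theorem shiftIndex_injective {d : ℕ} (v : Site d) : Function.Injective (shiftIndex v) := by
  refine Function.Injective.sumMap (fun e e' he => ?_) (add_left_injective v)
  exact Subtype.ext (Sym2.map.injective (add_left_injective v) (Subtype.ext_iff.1 he))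

theorem measurable_logPartition2_of_index {d : ℕ} (Λ : Finset (Site d)) (β lam : ℝ) :
    Measurable fun y : DisorderIndex d → ℝ =>
      logPartition2 Λ β lam (couplingOf y) (fieldOf y) 0 := by
  refine measurable_logPartition2 (b := fun _ => 0) (fun e he => ?_)
    (fun x => measurable_pi_apply _) (fun u _ => measurable_const) β lam
  simp only [couplingOf_of_mem _ he]
  exact measurable_pi_apply _

theorem logPartition2_eq_index {d : ℕ} {Ω : Type*} (Λ : Finset (Site d)) (β lam : ℝ)
    (J : Sym2 (Site d) → Ω → ℝ) (h : Site d → Ω → ℝ) (ω : Ω) :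
    logPartition2 Λ β lam (fun e => J e ω) (fun x => h x ω) 0 =
      logPartition2 Λ β lam
        (couplingOf fun i => Sum.elim (fun e : (lattice d).edgeSet => J e) h i ω)
        (fieldOf fun i => Sum.elim (fun e : (lattice d).edgeSet => J e) h i ω) 0 := by
  refine logPartition2_congr β lam (fun e he => ?_) fun x _ => rfl
  rw [couplingOf_of_mem _ (mem_edgeSet_of_mem_bonds he)]
  rfl

/-- The standing assumptions on the couplings and fields. -/
structure IsDisorder {d : ℕ} {Ω : Type*} [MeasurableSpace Ω] (μ : Measure Ω)
    (J : Sym2 (Site d) → Ω → ℝ) (h : Site d → Ω → ℝ) : Prop where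
  measurable_coupling : ∀ e ∈ (lattice d).edgeSet, Measurable (J e)
  measurable_field : ∀ x, Measurable (h x)
  indep : iIndepFun (Sum.elim (fun e : (lattice d).edgeSet => J e) h : DisorderIndex d → Ω → ℝ) μ
  ident_coupling : ∀ e ∈ (lattice d).edgeSet, ∀ e' ∈ (lattice d).edgeSet,
      IdentDistrib (J e) (J e') μ μ
  ident_field : ∀ x y, IdentDistrib (h x) (h y) μ μ
  integrable_coupling : ∀ e ∈ (lattice d).edgeSet, Integrable (J e) μ
  integrable_field : ∀ x, Integrable (h x) μ

namespace IsDisorder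

variable {d : ℕ} {Ω : Type*} [MeasurableSpace Ω] {μ : Measure Ω}
  {J : Sym2 (Site d) → Ω → ℝ} {h : Site d → Ω → ℝ}

theorem measurable_elim (H : IsDisorder μ J h) (i : DisorderIndex d) :
    Measurable (Sum.elim (fun e : (lattice d).edgeSet => J e) h i) := by
  rcases i with e | x
  · exact H.measurable_coupling e e.2
  · exact H.measurable_field x

/-- Independence makes the joint law the product of its marginals, also after an injective
reindexing. The shift sends bonds to bonds and sites to sites, so the marginals agree. -/
theorem identDistrib_shift [IsProbabilityMeasure μ] (H : IsDisorder μ J h) (v : Site d) :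
    IdentDistrib
      (fun ω i => Sum.elim (fun e : (lattice d).edgeSet => J e) h (shiftIndex v i) ω)
      (fun ω i => Sum.elim (fun e : (lattice d).edgeSet => J e) h i ω) μ μ := by
  refine ⟨(measurable_pi_lambda _ fun i => H.measurable_elim _).aemeasurable,
    (measurable_pi_lambda _ fun i => H.measurable_elim _).aemeasurable, ?_⟩
  rw [(iIndepFun_iff_map_fun_eq_infinitePi_map H.measurable_elim).1 H.indep,
    (iIndepFun_iff_map_fun_eq_infinitePi_map fun i => H.measurable_elim _).1
      (H.indep.precomp (shiftIndex_injective v))]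
  congr 1
  funext i
  rcases i with e | x
  · exact (H.ident_coupling _ (map_add_mem_edgeSet.2 e.2) e e.2).map_eq
  · exact (H.ident_field (x + v) x).map_eq

/-- The law of the free energy of a region is invariant under translations. -/
theorem identDistrib_logPartition2_translate [IsProbabilityMeasure μ] (H : IsDisorder μ J h)
    (v : Site d) (Λ : Finset (Site d)) (β lam : ℝ) :
    IdentDistrib
      (fun ω => logPartition2 (translate v Λ) β lam (fun e => J e ω) (fun x => h x ω) 0)
      (fun ω => logPartition2 Λ β lam (fun e => J e ω) (fun x => h x ω) 0) μ μ := by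
  have := (H.identDistrib_shift v).comp (measurable_logPartition2_of_index Λ β lam)
  convert this using 1
  · funext ω
    rw [logPartition2_translate]
    refine logPartition2_congr β lam (fun e he => ?_) fun x _ => rfl
    rw [couplingOf_of_mem _ (mem_edgeSet_of_mem_bonds he)]
    rfl
  · funext ω
    exact logPartition2_eq_index Λ β lam J h ω

open Classical in
/-- The free energies of disjoint regions are independent. -/
theorem indepFun_logPartition2 [IsProbabilityMeasure μ] (H : IsDisorder μ J h)
    {A B : Finset (Site d)} (hAB : Disjoint A B) (β lam : ℝ) :
    IndepFun (fun ω => logPartition2 A β lam (fun e => J e ω) (fun x => h x ω) 0)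
      (fun ω => logPartition2 B β lam (fun e => J e ω) (fun x => h x ω) 0) μ := by
  -- The finitely many disorder variables that a region reads. Extending by zero outside this set is
  -- harmless by locality, and disjoint regions have disjoint sets.
  set S : Finset (Site d) → Finset (DisorderIndex d) := fun Λ =>
    ((bonds Λ).subtype (· ∈ (lattice d).edgeSet)).disjSum Λ with hS
  set ext : ∀ T : Finset (DisorderIndex d), (T → ℝ) → DisorderIndex d → ℝ := fun T y i =>
    if hi : i ∈ T then y ⟨i, hi⟩ else 0 with hext
  have hextm : ∀ T, Measurable (ext T) := fun T => by
    refine measurable_pi_lambda _ fun i => ?_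
    simp only [hext]
    split_ifs with hi
    · exact measurable_pi_apply _
    · exact measurable_const
  have heq : ∀ Λ : Finset (Site d),
      (fun ω => logPartition2 Λ β lam (fun e => J e ω) (fun x => h x ω) 0) =
      (fun y : S Λ → ℝ => logPartition2 Λ β lam (couplingOf (ext _ y)) (fieldOf (ext _ y)) 0) ∘
        fun ω (i : S Λ) => Sum.elim (fun e : (lattice d).edgeSet => J e) h i ω := by
    intro Λ
    funext ω
    refine logPartition2_congr β lam (fun e he => ?_) fun x hx => ?_
    · have hm : (Sum.inl ⟨e, mem_edgeSet_of_mem_bonds he⟩ : DisorderIndex d) ∈ S Λ := by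
        simpa [hS] using he
      rw [couplingOf_of_mem _ (mem_edgeSet_of_mem_bonds he)]
      simp only [hext, dif_pos hm]
      rfl
    · have hm : (Sum.inr x : DisorderIndex d) ∈ S Λ := by simpa [hS] using hx
      simp only [fieldOf, hext, dif_pos hm]
      rfl
  have hdisj : Disjoint (S A) (S B) := by
    refine Finset.disjoint_left.2 ?_
    rintro (e | x) hA hB
    · simp only [hS, Finset.inl_mem_disjSum, Finset.mem_subtype] at hA hB
      exact Finset.disjoint_left.1 (disjoint_bonds hAB) hA hB
    · simp only [hS, Finset.inr_mem_disjSum] at hA hB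
      exact Finset.disjoint_left.1 hAB hA hB
  rw [heq A, heq B]
  exact (H.indep.indepFun_finset _ _ hdisj H.measurable_elim).comp
    ((measurable_logPartition2_of_index A β lam).comp (hextm _))
    ((measurable_logPartition2_of_index B β lam).comp (hextm _))

theorem integrable_sum_boundaryBonds (H : IsDisorder μ J h) (Λ : Finset (Site d)) :
    Integrable (fun ω => ∑ p ∈ boundaryBonds Λ, |J s(p.1, p.2) ω|) μ :=
  integrable_finsetSum _ fun _ hp =>
    (H.integrable_coupling _ (mem_edgeSet_of_mem_boundaryBonds hp)).abs

theorem integrable_logPartition2 [IsProbabilityMeasure μ] (H : IsDisorder μ J h)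
    (Λ : Finset (Site d)) {β : ℝ} (hβ : 0 ≤ β) (lam : ℝ) :
    Integrable (fun ω => logPartition2 Λ β lam (fun e => J e ω) (fun x => h x ω) 0) μ := by
  refine Integrable.mono' (g := fun ω => 2 * β * (∑ e ∈ bonds Λ, |J e ω| + ∑ x ∈ Λ, |h x ω|) +
      (β * |lam| * Λ.card + Real.log (Fintype.card (Config Λ × Config Λ)))) ?_ ?_
    (Eventually.of_forall fun ω => abs_logPartition2_le hβ lam _ _)
  · refine Integrable.add (Integrable.const_mul (Integrable.add ?_ ?_) _) (integrable_const _)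
    · exact integrable_finsetSum _ fun e he =>
        (H.integrable_coupling e (mem_edgeSet_of_mem_bonds he)).abs
    · exact integrable_finsetSum _ fun x _ => (H.integrable_field x).abs
  · exact (measurable_logPartition2 (J := fun ω e => J e ω) (h := fun ω x => h x ω)
      (b := fun _ => 0) H.measurable_coupling H.measurable_field
      (fun _ _ => measurable_const) β lam).aestronglyMeasurable

/-- Identical distribution gives one bound for all bonds; the case of no bonds arises because the
dimension is not assumed positive here. -/
theorem exists_integral_abs_coupling_le (H : IsDisorder μ J h) :
    ∃ m : ℝ, 0 ≤ m ∧ ∀ e ∈ (lattice d).edgeSet, ∫ ω, |J e ω| ∂μ ≤ m := by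
  rcases (lattice d).edgeSet.eq_empty_or_nonempty with h0 | ⟨e₀, he₀⟩
  · exact ⟨0, le_rfl, fun e he => by simp [h0] at he⟩
  · exact ⟨∫ ω, |J e₀ ω| ∂μ, integral_nonneg fun _ => abs_nonneg _, fun e he =>
      ((H.ident_coupling e he e₀ he₀).comp measurable_id.abs).integral_eq.le⟩

theorem integral_sum_boundaryBonds_le (H : IsDisorder μ J h) {m : ℝ}
    (hm : ∀ e ∈ (lattice d).edgeSet, ∫ ω, |J e ω| ∂μ ≤ m) (Λ : Finset (Site d)) :
    ∫ ω, ∑ p ∈ boundaryBonds Λ, |J s(p.1, p.2) ω| ∂μ ≤ (boundaryBonds Λ).card * m := by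
  rw [integral_finsetSum _ fun p hp =>
    (H.integrable_coupling _ (mem_edgeSet_of_mem_boundaryBonds hp)).abs, ← nsmul_eq_mul]
  exact Finset.sum_le_card_nsmul _ _ _ fun p hp => hm _ (mem_edgeSet_of_mem_boundaryBonds hp)

/-- Translating the site to the origin makes the cost of a leftover site uniform in its position. -/
theorem exists_integral_singleton_le [IsProbabilityMeasure μ] (H : IsDisorder μ J h) {β : ℝ}
    (hβ : 0 ≤ β) (lam : ℝ) : ∃ C : ℝ, 0 ≤ C ∧ ∀ x : Site d,
      ∫ ω, (2 * β * ∑ p ∈ boundaryBonds {x}, |J s(p.1, p.2) ω| +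
        |logPartition2 {x} β lam (fun e => J e ω) (fun x => h x ω) 0|) ∂μ ≤ C := by
  obtain ⟨m, hm0, hm⟩ := H.exists_integral_abs_coupling_le
  refine ⟨2 * β * ((boundaryBonds ({0} : Finset (Site d))).card * m) + ∫ ω,
    |logPartition2 {0} β lam (fun e => J e ω) (fun x => h x ω) 0| ∂μ,
    add_nonneg (by positivity) (integral_nonneg fun _ => abs_nonneg _), fun x => ?_⟩
  have hx : ({x} : Finset (Site d)) = translate x {0} := by
    ext y
    rw [mem_translate, Finset.mem_singleton, Finset.mem_singleton, sub_eq_zero]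
  rw [integral_add ((H.integrable_sum_boundaryBonds _).const_mul _)
    (H.integrable_logPartition2 _ hβ lam).abs, integral_const_mul, hx]
  refine add_le_add (mul_le_mul_of_nonneg_left ?_ (by positivity))
    ((H.identDistrib_logPartition2_translate x {0} β lam).comp measurable_id.abs).integral_eq.le
  refine (H.integral_sum_boundaryBonds_le hm _).trans (mul_le_mul_of_nonneg_right ?_ hm0)
  exact_mod_cast card_boundaryBonds_translate_le x {0}

end IsDisorder

/-! ### Convergence of the free energy density to a constant -/

namespace IsDisorder

variable {d : ℕ} {Ω : Type*} [MeasurableSpace Ω] {μ : Measure Ω}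
  {J : Sym2 (Site d) → Ω → ℝ} {h : Site d → Ω → ℝ}

/-- The error in the block decomposition of the free energy, on average over the disorder. -/
theorem integral_abs_logPartition2_box_sub_le [IsProbabilityMeasure μ] (H : IsDisorder μ J h)
    {β : ℝ} (hβ : 0 ≤ β) (lam : ℝ) {m C : ℝ} (hm0 : 0 ≤ m)
    (hm : ∀ e ∈ (lattice d).edgeSet, ∫ ω, |J e ω| ∂μ ≤ m)
    (hC : ∀ x : Site d, ∫ ω, (2 * β * ∑ p ∈ boundaryBonds {x}, |J s(p.1, p.2) ω| +
        |logPartition2 {x} β lam (fun e => J e ω) (fun x => h x ω) 0|) ∂μ ≤ C)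
    {M k L : ℕ} (hk : k * M ≤ L) :
    ∫ ω, |logPartition2 (box d L) β lam (fun e => J e ω) (fun x => h x ω) 0 -
        ∑ v ∈ blockIndices d k,
          logPartition2 (block M v) β lam (fun e => J e ω) (fun x => h x ω) 0| ∂μ ≤
      (k : ℝ) ^ d * (2 * β * ((boundaryBonds (box d M)).card * m)) +
        ((L : ℝ) ^ d - (k : ℝ) ^ d * (M : ℝ) ^ d) * C := by
  have hi1 : ∀ Λ : Finset (Site d),
      Integrable (fun ω => 2 * β * ∑ p ∈ boundaryBonds Λ, |J s(p.1, p.2) ω|) μ := fun Λ =>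
    (H.integrable_sum_boundaryBonds Λ).const_mul _
  have hi2 : ∀ x : Site d, Integrable (fun ω =>
      2 * β * ∑ p ∈ boundaryBonds {x}, |J s(p.1, p.2) ω| +
        |logPartition2 {x} β lam (fun e => J e ω) (fun x => h x ω) 0|) μ := fun x =>
    (hi1 _).add (H.integrable_logPartition2 _ hβ lam).abs
  have hs1 : Integrable (fun ω => ∑ v ∈ blockIndices d k,
      2 * β * ∑ p ∈ boundaryBonds (block M v), |J s(p.1, p.2) ω|) μ :=
    integrable_finsetSum _ fun v _ => hi1 (block M v)
  have hs2 : Integrable (fun ω => ∑ x ∈ remainder d M k L,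
      (2 * β * ∑ p ∈ boundaryBonds {x}, |J s(p.1, p.2) ω| +
        |logPartition2 {x} β lam (fun e => J e ω) (fun x => h x ω) 0|)) μ :=
    integrable_finsetSum _ fun x _ => hi2 x
  have hle := fun ω => abs_logPartition2_box_sub_le hk hβ lam (fun e => J e ω) (fun x => h x ω)
  refine (integral_mono_of_nonneg (Eventually.of_forall fun ω => abs_nonneg _) (hs1.add hs2)
    (Eventually.of_forall hle)).trans ?_
  rw [integral_add' hs1 hs2, integral_finsetSum _ fun v _ => hi1 _,
    integral_finsetSum _ fun x _ => hi2 x]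
  refine add_le_add ?_ ?_
  · have : ((blockIndices d k).card : ℝ) = (k : ℝ) ^ d := by
      rw [card_blockIndices]; push_cast; rfl
    rw [← this, ← nsmul_eq_mul]
    refine Finset.sum_le_card_nsmul _ _ _ fun v _ => ?_
    rw [integral_const_mul]
    refine mul_le_mul_of_nonneg_left ?_ (by positivity)
    refine (H.integral_sum_boundaryBonds_le hm _).trans (mul_le_mul_of_nonneg_right ?_ hm0)
    exact Nat.cast_le.2 (card_boundaryBonds_translate_le _ _)
  · rw [← card_remainder hk, ← nsmul_eq_mul]
    exact Finset.sum_le_card_nsmul _ _ _ fun x _ => hC x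

/-- The free energy density concentrates, up to an arbitrarily small error. -/
theorem exists_eventually_integral_abs_sub_le [IsProbabilityMeasure μ] (H : IsDisorder μ J h)
    (hd : 1 ≤ d) {β : ℝ} (hβ : 0 ≤ β) (lam : ℝ) {ε : ℝ} (hε : 0 < ε) :
    ∃ c : ℝ, ∀ᶠ L : ℕ in atTop,
      ∫ ω, |logPartition2 (box d L) β lam (fun e => J e ω) (fun x => h x ω) 0 / (L : ℝ) ^ d - c| ∂μ
        ≤ ε := by
  obtain ⟨m, hm0, hm⟩ := H.exists_integral_abs_coupling_le
  obtain ⟨C, hC0, hC⟩ := H.exists_integral_singleton_le hβ lam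
  -- The block side is fixed first, so that the surface cost per site is below `ε / 4`. The constant
  -- `c` is then the mean of `log Z` per site in one block.
  obtain ⟨M, hMε, hM⟩ : ∃ M : ℕ,
      2 * β * m * (((boundaryBonds (box d M)).card : ℝ) / (M : ℝ) ^ d) < ε / 4 ∧ 1 ≤ M := by
    have ht := (tendsto_card_boundaryBonds_box_div d).const_mul (2 * β * m)
    rw [mul_zero] at ht
    exact ((ht.eventually (gt_mem_nhds (by linarith))).and (eventually_ge_atTop 1)).exists
  have hM0 : (0 : ℝ) < (M : ℝ) ^ d := by positivity
  have hMb : 2 * β * ((boundaryBonds (box d M)).card * m) ≤ ε / 4 * (M : ℝ) ^ d := by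
    rw [← div_le_iff₀ hM0]
    refine le_trans (le_of_eq ?_) hMε.le
    ring
  set a := ∫ ω, logPartition2 (box d M) β lam (fun e => J e ω) (fun x => h x ω) 0 ∂μ with ha
  set c := a / (M : ℝ) ^ d with hc
  have hac : a = c * (M : ℝ) ^ d := by rw [hc]; field_simp
  obtain ⟨n₀, hn₀⟩ := exists_integral_abs_sum_sub_le
    (X := fun v ω => logPartition2 (block M v) β lam (fun e => J e ω) (fun x => h x ω) 0)
    (H.integrable_logPartition2 (box d M) hβ lam)
    (fun v => H.identDistrib_logPartition2_translate _ _ β lam)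
    (fun v w hvw => H.indepFun_logPartition2 (disjoint_block hvw) β lam)
    (show 0 < ε / 4 by linarith)
  -- The fraction of sites outside the blocks vanishes. Each such site costs `C` for its own free
  -- energy and `|c|` for its share of the constant.
  have hratio : Tendsto (fun L : ℕ => (C + |c|) *
      (1 - (((L / M : ℕ) : ℝ) * M / L) ^ d)) atTop (𝓝 0) := by
    have h1 : Tendsto (fun L : ℕ => ((L / M : ℕ) : ℝ) * M / L) atTop (𝓝 1) := by
      have h2 : Tendsto (fun L : ℕ => 1 - (M : ℝ) / L) atTop (𝓝 (1 - 0)) :=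
        (tendsto_const_div_atTop_nhds_zero_nat (M : ℝ)).const_sub 1
      rw [sub_zero] at h2
      refine tendsto_of_tendsto_of_tendsto_of_le_of_le' h2 tendsto_const_nhds ?_ ?_
      · filter_upwards [eventually_gt_atTop 0] with L hL
        have hL0 : (0 : ℝ) < L := by exact_mod_cast hL
        rw [le_div_iff₀ hL0, sub_mul, one_mul, div_mul_cancel₀ _ hL0.ne', sub_le_iff_le_add]
        have := (Nat.lt_div_mul_add (a := L) hM).le
        exact_mod_cast this
      · filter_upwards [eventually_gt_atTop 0] with L hL
        have hL0 : (0 : ℝ) < L := by exact_mod_cast hL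
        rw [div_le_one hL0]
        exact_mod_cast Nat.div_mul_le_self L M
    have h3 := ((h1.pow d).const_sub 1).const_mul (C + |c|)
    rwa [one_pow, sub_self, mul_zero] at h3
  -- The number of blocks must diverge for the law of large numbers; this is where `1 ≤ d` enters.
  have hlarge : Tendsto (fun L : ℕ => (L / M) ^ d) atTop atTop :=
    (tendsto_pow_atTop (by omega)).comp (Nat.tendsto_div_const_atTop (by omega))
  refine ⟨c, ?_⟩
  filter_upwards [hratio.eventually (gt_mem_nhds (show 0 < ε / 4 by linarith)),
    hlarge.eventually_ge_atTop n₀, eventually_gt_atTop 0] with L hL1 hL2 hL3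
  have hL0 : (0 : ℝ) < (L : ℝ) ^ d := by positivity
  set k := L / M with hkdef
  have hk : k * M ≤ L := Nat.div_mul_le_self L M
  have hkL : (k : ℝ) ^ d * (M : ℝ) ^ d ≤ (L : ℝ) ^ d := by
    rw [← mul_pow]
    gcongr
    exact_mod_cast hk
  have hrem : ((L : ℝ) ^ d - (k : ℝ) ^ d * (M : ℝ) ^ d) * (C + |c|) ≤ ε / 4 * (L : ℝ) ^ d := by
    rw [← div_le_iff₀ hL0]
    refine le_trans (le_of_eq ?_) hL1.le
    rw [div_pow, mul_pow]
    field_simp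
  have hlln := hn₀ (blockIndices d k) (by rw [card_blockIndices]; exact hL2)
  have hcard : ((blockIndices d k).card : ℝ) = (k : ℝ) ^ d := by
    rw [card_blockIndices]; push_cast; rfl
  rw [hcard] at hlln
  have hdec := H.integral_abs_logPartition2_box_sub_le hβ lam hm0 hm hC hk
  set F : Ω → ℝ := fun ω => logPartition2 (box d L) β lam (fun e => J e ω) (fun x => h x ω) 0
  set G : Ω → ℝ := fun ω => ∑ v ∈ blockIndices d k,
    logPartition2 (block M v) β lam (fun e => J e ω) (fun x => h x ω) 0
  have hF : Integrable F μ := H.integrable_logPartition2 _ hβ lam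
  have hG : Integrable G μ := integrable_finsetSum _ fun v _ => H.integrable_logPartition2 _ hβ lam
  have hGa : Integrable (fun ω => |G ω - (k : ℝ) ^ d * a|) μ := (hG.sub (integrable_const _)).abs
  have hFG : Integrable (fun ω => |F ω - G ω|) μ := (hF.sub hG).abs
  have hFGa : Integrable (fun ω => |F ω - G ω| + |G ω - (k : ℝ) ^ d * a|) μ := hFG.add hGa
  have hkd : (k : ℝ) ^ d * 1 ≤ (k : ℝ) ^ d * (M : ℝ) ^ d := by
    refine mul_le_mul_of_nonneg_left (one_le_pow₀ ?_) (by positivity)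
    exact_mod_cast hM
  have hmain : ∫ ω, |F ω - (L : ℝ) ^ d * c| ∂μ ≤ ε * (L : ℝ) ^ d := by
    calc ∫ ω, |F ω - (L : ℝ) ^ d * c| ∂μ
        ≤ ∫ ω, (|F ω - G ω| + |G ω - (k : ℝ) ^ d * a| +
          ((L : ℝ) ^ d - (k : ℝ) ^ d * (M : ℝ) ^ d) * |c|) ∂μ := by
          refine integral_mono_of_nonneg (Eventually.of_forall fun ω => abs_nonneg _)
            (hFGa.add (integrable_const _)) (Eventually.of_forall fun ω => ?_)
          have e : F ω - (L : ℝ) ^ d * c = (F ω - G ω) + (G ω - (k : ℝ) ^ d * a) +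
              -(((L : ℝ) ^ d - (k : ℝ) ^ d * (M : ℝ) ^ d) * c) := by rw [hac]; ring
          simp only
          rw [e]
          refine (abs_add_three _ _ _).trans_eq ?_
          rw [abs_neg, abs_mul _ c, abs_of_nonneg (sub_nonneg.2 hkL)]
      _ = ∫ ω, |F ω - G ω| ∂μ + ∫ ω, |G ω - (k : ℝ) ^ d * a| ∂μ +
          ((L : ℝ) ^ d - (k : ℝ) ^ d * (M : ℝ) ^ d) * |c| := by
          rw [integral_add hFGa (integrable_const _), integral_add hFG hGa]
          simp
      _ ≤ ((k : ℝ) ^ d * (2 * β * ((boundaryBonds (box d M)).card * m)) +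
          ((L : ℝ) ^ d - (k : ℝ) ^ d * (M : ℝ) ^ d) * C) + ε / 4 * (k : ℝ) ^ d +
          ((L : ℝ) ^ d - (k : ℝ) ^ d * (M : ℝ) ^ d) * |c| := by gcongr
      _ ≤ ((k : ℝ) ^ d * (ε / 4 * (M : ℝ) ^ d) +
          ((L : ℝ) ^ d - (k : ℝ) ^ d * (M : ℝ) ^ d) * C) + ε / 4 * (k : ℝ) ^ d +
          ((L : ℝ) ^ d - (k : ℝ) ^ d * (M : ℝ) ^ d) * |c| := by gcongr
      _ ≤ _ := by nlinarith
  calc _ = ∫ ω, ((L : ℝ) ^ d)⁻¹ * |F ω - (L : ℝ) ^ d * c| ∂μ := by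
        refine integral_congr_ae (Eventually.of_forall fun ω => ?_)
        have : F ω / (L : ℝ) ^ d - c = ((L : ℝ) ^ d)⁻¹ * (F ω - (L : ℝ) ^ d * c) := by
          field_simp
        simp only
        rw [this, abs_mul, abs_of_pos (inv_pos.2 hL0)]
    _ = ((L : ℝ) ^ d)⁻¹ * ∫ ω, |F ω - (L : ℝ) ^ d * c| ∂μ := integral_const_mul _ _
    _ ≤ ((L : ℝ) ^ d)⁻¹ * (ε * (L : ℝ) ^ d) := by gcongr
    _ = ε := by field_simp

/-- The free energy density converges in `L¹` to a constant. -/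
theorem exists_tendsto_integral_abs_sub [IsProbabilityMeasure μ] (H : IsDisorder μ J h)
    (hd : 1 ≤ d) {β : ℝ} (hβ : 0 ≤ β) (lam : ℝ) :
    ∃ p : ℝ, Tendsto (fun L : ℕ => ∫ ω,
      |logPartition2 (box d L) β lam (fun e => J e ω) (fun x => h x ω) 0 / (L : ℝ) ^ d - p| ∂μ)
        atTop (𝓝 0) := by
  set g : ℕ → Ω → ℝ := fun L ω =>
    logPartition2 (box d L) β lam (fun e => J e ω) (fun x => h x ω) 0 / (L : ℝ) ^ d with hg
  have hgi : ∀ L, Integrable (g L) μ := fun L =>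
    (H.integrable_logPartition2 _ hβ lam).div_const _
  have hdist : ∀ L c, |∫ ω, g L ω ∂μ - c| ≤ ∫ ω, |g L ω - c| ∂μ := fun L c => by
    have : ∫ ω, g L ω ∂μ - c = ∫ ω, (g L ω - c) ∂μ := by
      rw [integral_sub (hgi L) (integrable_const _)]; simp
    rw [this]
    exact abs_integral_le_integral_abs
  have hconc : ∀ ε > 0, ∃ c : ℝ, ∀ᶠ L : ℕ in atTop, ∫ ω, |g L ω - c| ∂μ ≤ ε := fun ε hε =>
    H.exists_eventually_integral_abs_sub_le hd hβ lam hε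
  -- The constant `c` depends on `ε`. The means lie eventually within `ε` of it, so they are Cauchy,
  -- and their limit serves for every `ε`.
  have hcauchy : CauchySeq fun L => ∫ ω, g L ω ∂μ := by
    refine Metric.cauchySeq_iff.2 fun ε hε => ?_
    obtain ⟨c, hc⟩ := hconc (ε / 3) (by linarith)
    obtain ⟨N, hN⟩ := eventually_atTop.1 hc
    refine ⟨N, fun m hm n hn => ?_⟩
    have h1 := (hdist m c).trans (hN m hm)
    have h2 := (hdist n c).trans (hN n hn)
    rw [Real.dist_eq]
    rw [abs_le] at h1 h2
    rw [abs_lt]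
    constructor <;> linarith
  obtain ⟨p, hp⟩ := cauchySeq_tendsto_of_complete hcauchy
  refine ⟨p, Metric.tendsto_atTop'.2 fun ε hε => ?_⟩
  obtain ⟨c, hc⟩ := hconc (ε / 3) (by linarith)
  have hpc : |p - c| ≤ ε / 3 := by
    refine le_of_tendsto (hp.sub_const c).abs ?_
    filter_upwards [hc] with L hL
    exact (hdist L c).trans hL
  obtain ⟨N, hN⟩ := eventually_atTop.1 hc
  refine ⟨N, fun L hL => ?_⟩
  rw [Real.dist_eq, sub_zero, abs_of_nonneg (integral_nonneg fun _ => abs_nonneg _)]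
  have hi : Integrable (fun ω => |g L ω - c|) μ := ((hgi L).sub (integrable_const _)).abs
  calc ∫ ω, |g L ω - p| ∂μ ≤ ∫ ω, (|g L ω - c| + |p - c|) ∂μ := by
        refine integral_mono_of_nonneg (Eventually.of_forall fun ω => abs_nonneg _)
          (hi.add (integrable_const _)) (Eventually.of_forall fun ω => ?_)
        rw [abs_sub_comm p c]
        exact abs_sub_le _ _ _
    _ = ∫ ω, |g L ω - c| ∂μ + |p - c| := by
        rw [integral_add hi (integrable_const _)]; simp
    _ < ε := by linarith [hN L hL.le]

end IsDisorder

/-! ### Thermal expectations and the Chernoff bound -/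

section Gibbs

variable {d : ℕ} (Λ : Finset (Site d)) (β lam : ℝ) (J : Sym2 (Site d) → ℝ) (h b : Site d → ℝ)

theorem gibbs2_mono {F G : Config Λ → Config Λ → ℝ} (hFG : ∀ σ₁ σ₂, F σ₁ σ₂ ≤ G σ₁ σ₂) :
    gibbs2 Λ β lam J h b F ≤ gibbs2 Λ β lam J h b G :=
  mul_le_mul_of_nonneg_left
    (Finset.sum_le_sum fun σ₁ _ => Finset.sum_le_sum fun σ₂ _ =>
      mul_le_mul_of_nonneg_right (hFG σ₁ σ₂) (Real.exp_pos _).le)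
    (inv_nonneg.2 (partition2_pos Λ β lam J h b).le)

theorem gibbs2_add (F G : Config Λ → Config Λ → ℝ) :
    gibbs2 Λ β lam J h b (fun σ₁ σ₂ => F σ₁ σ₂ + G σ₁ σ₂) =
      gibbs2 Λ β lam J h b F + gibbs2 Λ β lam J h b G := by
  simp only [gibbs2, add_mul, Finset.sum_add_distrib, mul_add]

theorem gibbs2_const_mul (c : ℝ) (F : Config Λ → Config Λ → ℝ) :
    gibbs2 Λ β lam J h b (fun σ₁ σ₂ => c * F σ₁ σ₂) = c * gibbs2 Λ β lam J h b F := by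
  simp only [gibbs2, mul_assoc, ← Finset.mul_sum]
  ring

theorem gibbs2_const (c : ℝ) : gibbs2 Λ β lam J h b (fun _ _ => c) = c := by
  simp only [gibbs2, ← Finset.mul_sum]
  rw [mul_comm c, ← mul_assoc]
  exact (congrArg (· * c) (inv_mul_cancel₀ (partition2_pos Λ β lam J h b).ne')).trans (one_mul c)

theorem abs_gibbs2_le {F : Config Λ → Config Λ → ℝ} {K : ℝ} (hF : ∀ σ₁ σ₂, |F σ₁ σ₂| ≤ K) :
    |gibbs2 Λ β lam J h b F| ≤ K := by
  rw [abs_le]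
  constructor
  · rw [← gibbs2_const Λ β lam J h b (-K)]
    exact gibbs2_mono _ _ _ _ _ _ fun σ₁ σ₂ => (abs_le.1 (hF σ₁ σ₂)).1
  · refine le_trans ?_ (gibbs2_const Λ β lam J h b K).le
    exact gibbs2_mono _ _ _ _ _ _ fun σ₁ σ₂ => (abs_le.1 (hF σ₁ σ₂)).2

/-- The exponential moments of the total overlap are ratios of partition functions. -/
theorem gibbs2_exp_overlap :
    gibbs2 Λ β 0 J h b (fun σ₁ σ₂ => Real.exp (β * (lam * ∑ x ∈ Λ, spin σ₁ x * spin σ₂ x))) =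
      Real.exp (logPartition2 Λ β lam J h b - logPartition2 Λ β 0 J h b) := by
  rw [Real.exp_sub, logPartition2, logPartition2, Real.exp_log (partition2_pos _ _ _ _ _ _),
    Real.exp_log (partition2_pos _ _ _ _ _ _), div_eq_inv_mul, gibbs2]
  congr 1
  refine Finset.sum_congr rfl fun σ₁ _ => Finset.sum_congr rfl fun σ₂ _ => ?_
  rw [← Real.exp_add]
  congr 1
  unfold hamiltonian2
  ring

end Gibbs

theorem abs_overlap_le_one {d L : ℕ} (σ₁ σ₂ : Config (box d L)) : |overlap d L σ₁ σ₂| ≤ 1 := by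
  have h1 := abs_sum_spin_mul_spin_le σ₁ σ₂
  rw [card_box, Nat.cast_pow] at h1
  rw [overlap, abs_mul, abs_of_nonneg (by positivity)]
  exact (mul_le_mul_of_nonneg_left h1 (by positivity)).trans (inv_mul_le_one)

/-- A Chernoff bound for the overlap. -/
theorem gibbs2_overlap_tail_le {d L : ℕ} (hL : 0 < L) {β : ℝ} (hβ : 0 < β) (lam a : ℝ)
    (J : Sym2 (Site d) → ℝ) (h b : Site d → ℝ) :
    gibbs2 (box d L) β 0 J h b
      (fun σ₁ σ₂ => if lam * a ≤ lam * overlap d L σ₁ σ₂ then 1 else 0) ≤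
      Real.exp ((L : ℝ) ^ d * (logPartition2 (box d L) β lam J h b / (L : ℝ) ^ d -
        logPartition2 (box d L) β 0 J h b / (L : ℝ) ^ d - β * lam * a)) := by
  have hL0 : (0 : ℝ) < (L : ℝ) ^ d := by positivity
  have he : Real.exp ((L : ℝ) ^ d * (logPartition2 (box d L) β lam J h b / (L : ℝ) ^ d -
        logPartition2 (box d L) β 0 J h b / (L : ℝ) ^ d - β * lam * a)) =
      Real.exp (-((L : ℝ) ^ d * (β * lam * a))) *
        Real.exp (logPartition2 (box d L) β lam J h b - logPartition2 (box d L) β 0 J h b) := by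
    rw [← Real.exp_add]
    congr 1
    field_simp
    ring
  rw [he, ← gibbs2_exp_overlap, ← gibbs2_const_mul]
  -- The indicator is at most `exp (β lam L^d (R - a))`. Keeping the factor `lam` in the event
  -- covers the upper tail for `lam > 0` and the lower tail for `lam < 0` at once.
  refine gibbs2_mono _ _ _ _ _ _ fun σ₁ σ₂ => ?_
  split_ifs with hle
  · rw [← Real.exp_add]
    refine Real.one_le_exp ?_
    have hs : ∑ x ∈ box d L, spin σ₁ x * spin σ₂ x = (L : ℝ) ^ d * overlap d L σ₁ σ₂ := by
      rw [overlap]; field_simp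
    rw [hs]
    have := mul_nonneg (mul_pos hβ hL0).le (sub_nonneg.2 hle)
    linarith
  · positivity

/-- An exponential of a quantity that is negative up to fluctuations, capped at one. -/
theorem le_exp_neg_add_of_le_exp {x y u v s t N δ : ℝ} (hδ : 0 < δ) (hN : 0 ≤ N) (hx1 : x ≤ 1)
    (hx : x ≤ Real.exp (N * (u - v - y))) (hst : s - t - y ≤ -(3 * δ)) :
    x ≤ Real.exp (-(N * δ)) + (|u - s| + |v - t|) / δ := by
  have hexp := Real.exp_pos (-(N * δ))
  -- Large fluctuations make the second term at least one, as in Markov's inequality. Otherwise each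
  -- deviation is below `δ`, and the margin `3δ` leaves an exponent of at most `-N δ`.
  by_cases hc : δ ≤ |u - s| + |v - t|
  · have := (one_le_div hδ).2 hc
    linarith
  · have h1 := abs_lt.1 (lt_of_le_of_lt (le_add_of_nonneg_right (abs_nonneg (v - t)))
      (not_le.1 hc))
    have h2 := abs_lt.1 (lt_of_le_of_lt (le_add_of_nonneg_left (abs_nonneg (u - s)))
      (not_le.1 hc))
    refine hx.trans (le_add_of_le_of_nonneg (Real.exp_le_exp.2 ?_) (by positivity))
    rw [← mul_neg]
    exact mul_le_mul_of_nonneg_left (by linarith) hN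

/-! ### Overlap tails and the broadening order parameter -/

namespace IsDisorder

variable {d : ℕ} {Ω : Type*} [MeasurableSpace Ω] {μ : Measure Ω}
  {J : Sym2 (Site d) → Ω → ℝ} {h : Site d → Ω → ℝ}

theorem integrable_gibbs2 [IsProbabilityMeasure μ] (H : IsDisorder μ J h) (Λ : Finset (Site d))
    (β lam : ℝ) (F : Config Λ → Config Λ → ℝ) {K : ℝ} (hF : ∀ σ₁ σ₂, |F σ₁ σ₂| ≤ K) :
    Integrable (fun ω => gibbs2 Λ β lam (fun e => J e ω) (fun x => h x ω) (fun _ => 0) F) μ :=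
  Integrable.of_bound
    (measurable_gibbs2 (J := fun ω e => J e ω) (h := fun ω x => h x ω) (b := fun _ _ => 0)
      H.measurable_coupling H.measurable_field (fun _ _ => measurable_const)
      β lam F).aestronglyMeasurable K
    (Eventually.of_forall fun _ => abs_gibbs2_le _ _ _ _ _ _ hF)

/-- Overlaps outside the interval of slopes of the free energy are unlikely. -/
theorem tendsto_integral_gibbs2_overlap_tail [IsProbabilityMeasure μ] (H : IsDisorder μ J h)
    (hd : 1 ≤ d) {β : ℝ} (hβ : 0 < β) {p : ℝ → ℝ}
    (hp : ∀ lam, Tendsto (fun L : ℕ => ∫ ω,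
      |logPartition2 (box d L) β lam (fun e => J e ω) (fun x => h x ω) 0 / (L : ℝ) ^ d - p lam| ∂μ)
        atTop (𝓝 0)) {lam a : ℝ} (hlam : p lam - p 0 < β * lam * a) :
    Tendsto (fun L : ℕ => ∫ ω, gibbs2 (box d L) β 0 (fun e => J e ω) (fun x => h x ω) (fun _ => 0)
      (fun σ₁ σ₂ => if lam * a ≤ lam * overlap d L σ₁ σ₂ then 1 else 0) ∂μ) atTop (𝓝 0) := by
  obtain ⟨δ, hδ, hδ'⟩ : ∃ δ, 0 < δ ∧ p lam - p 0 - β * lam * a ≤ -(3 * δ) :=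
    ⟨(β * lam * a - (p lam - p 0)) / 3, by linarith, by linarith⟩
  have hpow : Tendsto (fun L : ℕ => (L : ℝ) ^ d * δ) atTop atTop :=
    ((tendsto_pow_atTop (by omega)).comp tendsto_natCast_atTop_atTop).atTop_mul_const hδ
  have hlim := (Real.tendsto_exp_neg_atTop_nhds_zero.comp hpow).add
    (((hp lam).add (hp 0)).div_const δ)
  simp only [add_zero, zero_div] at hlim
  refine squeeze_zero' (Eventually.of_forall fun L => integral_nonneg fun ω => ?_) ?_ hlim
  · refine (gibbs2_const (box d L) β 0 (fun e => J e ω) (fun x => h x ω) (fun _ => 0) 0).ge.trans ?_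
    refine gibbs2_mono _ _ _ _ _ _ fun σ₁ σ₂ => ?_
    split_ifs <;> norm_num
  · filter_upwards [eventually_gt_atTop 0] with L hL
    have hg : ∀ l, Integrable (fun ω => |logPartition2 (box d L) β l (fun e => J e ω)
        (fun x => h x ω) 0 / (L : ℝ) ^ d - p l|) μ := fun l =>
      (((H.integrable_logPartition2 _ hβ.le l).div_const _).sub (integrable_const _)).abs
    have hsum : Integrable (fun ω =>
        (|logPartition2 (box d L) β lam (fun e => J e ω) (fun x => h x ω) 0 / (L : ℝ) ^ d - p lam| +
        |logPartition2 (box d L) β 0 (fun e => J e ω) (fun x => h x ω) 0 / (L : ℝ) ^ d - p 0|) / δ)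
        μ := ((hg lam).add (hg 0)).div_const δ
    have hind : ∀ σ₁ σ₂ : Config (box d L),
        |if lam * a ≤ lam * overlap d L σ₁ σ₂ then (1 : ℝ) else 0| ≤ 1 := fun σ₁ σ₂ => by
      split_ifs <;> norm_num
    calc _ ≤ ∫ ω, (Real.exp (-((L : ℝ) ^ d * δ)) +
          (|logPartition2 (box d L) β lam (fun e => J e ω) (fun x => h x ω) 0 / (L : ℝ) ^ d - p lam| +
          |logPartition2 (box d L) β 0 (fun e => J e ω) (fun x => h x ω) 0 / (L : ℝ) ^ d - p 0|) /
            δ) ∂μ := by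
          refine integral_mono (H.integrable_gibbs2 _ _ _ _ hind)
            ((integrable_const _).add hsum) fun ω => ?_
          exact le_exp_neg_add_of_le_exp hδ (by positivity)
            ((le_abs_self _).trans (abs_gibbs2_le _ _ _ _ _ _ hind))
            (gibbs2_overlap_tail_le hL hβ lam a _ _ _) hδ'
      _ = _ := by
          rw [integral_add (integrable_const _) hsum, integral_div, integral_add (hg lam) (hg 0)]
          simp

theorem overlapMoment_two_le_one [IsProbabilityMeasure μ] (β : ℝ)
    (J : Sym2 (Site d) → Ω → ℝ) (h : Site d → Ω → ℝ) (L : ℕ) :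
    overlapMoment μ J h β 2 L ≤ 1 := by
  have key : ‖overlapMoment μ J h β 2 L‖ ≤ 1 * μ.real Set.univ := by
    refine norm_integral_le_of_norm_le_const (Eventually.of_forall fun ω => ?_)
    refine abs_gibbs2_le _ _ _ _ _ _ fun σ₁ σ₂ => ?_
    rw [abs_pow]
    exact pow_le_one₀ (abs_nonneg _) (abs_overlap_le_one σ₁ σ₂)
  rw [probReal_univ, mul_one] at key
  exact (le_abs_self _).trans key

/-- The variance of the overlap is at most its mean square distance from any constant. -/
theorem overlap_variance_le [IsProbabilityMeasure μ] (H : IsDisorder μ J h) (β c : ℝ) (L : ℕ) :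
    overlapMoment μ J h β 2 L - overlapMoment μ J h β 1 L ^ 2 ≤
      ∫ ω, gibbs2 (box d L) β 0 (fun e => J e ω) (fun x => h x ω) (fun _ => 0)
        (fun σ₁ σ₂ => (overlap d L σ₁ σ₂ - c) ^ 2) ∂μ := by
  have hi : ∀ k : ℕ, Integrable (fun ω => gibbs2 (box d L) β 0 (fun e => J e ω) (fun x => h x ω)
      (fun _ => 0) (fun σ₁ σ₂ => overlap d L σ₁ σ₂ ^ k)) μ := fun k => by
    refine H.integrable_gibbs2 _ _ _ _ (K := 1) fun σ₁ σ₂ => ?_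
    rw [abs_pow]
    exact pow_le_one₀ (abs_nonneg _) (abs_overlap_le_one σ₁ σ₂)
  have he : ∀ ω, gibbs2 (box d L) β 0 (fun e => J e ω) (fun x => h x ω) (fun _ => 0)
        (fun σ₁ σ₂ => (overlap d L σ₁ σ₂ - c) ^ 2) =
      gibbs2 (box d L) β 0 (fun e => J e ω) (fun x => h x ω)
        (fun _ => 0) (fun σ₁ σ₂ => overlap d L σ₁ σ₂ ^ 2) +
      (-2 * c * gibbs2 (box d L) β 0 (fun e => J e ω) (fun x => h x ω)
        (fun _ => 0) (fun σ₁ σ₂ => overlap d L σ₁ σ₂ ^ 1) + c ^ 2) := fun ω => by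
    rw [← gibbs2_const_mul, ← gibbs2_const (box d L) β 0 (fun e => J e ω) (fun x => h x ω)
      (fun _ => 0) (c ^ 2), ← gibbs2_add, ← gibbs2_add]
    congr 1
    funext σ₁ σ₂
    ring
  have hi1 : Integrable (fun ω => -2 * c * gibbs2 (box d L) β 0 (fun e => J e ω) (fun x => h x ω)
      (fun _ => 0) (fun σ₁ σ₂ => overlap d L σ₁ σ₂ ^ 1) + c ^ 2) μ :=
    ((hi 1).const_mul _).add (integrable_const _)
  simp only [he]
  rw [integral_add (hi 2) hi1, integral_add ((hi 1).const_mul _) (integrable_const _), integral_const_mul]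
  change _ ≤ overlapMoment μ J h β 2 L + (-2 * c * overlapMoment μ J h β 1 L + _)
  rw [integral_const, probReal_univ, one_smul]
  -- The two sides differ by the square of the distance from the mean overlap to `c`.
  nlinarith [sq_nonneg (overlapMoment μ J h β 1 L - c)]

/-- The overlap has modulus at most one. The bound also keeps the real-valued `limsup` in `qBr` from
taking a default value. -/
theorem overlap_std_le_one [IsProbabilityMeasure μ] (β : ℝ)
    (J : Sym2 (Site d) → Ω → ℝ) (h : Site d → Ω → ℝ) (L : ℕ) :
    Real.sqrt (overlapMoment μ J h β 2 L - overlapMoment μ J h β 1 L ^ 2) ≤ 1 := by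
  refine Real.sqrt_le_one.2 ?_
  have := overlapMoment_two_le_one (μ := μ) β J h L
  nlinarith [sq_nonneg (overlapMoment μ J h β 1 L)]

theorem qBr_le_one [IsProbabilityMeasure μ] (β : ℝ)
    (J : Sym2 (Site d) → Ω → ℝ) (h : Site d → Ω → ℝ) : qBr μ J h β ≤ 1 :=
  limsup_le_of_le (isCoboundedUnder_le_of_le _ fun _ => Real.sqrt_nonneg _)
    (Eventually.of_forall (overlap_std_le_one β J h))

theorem qBr_nonneg [IsProbabilityMeasure μ] (β : ℝ)
    (J : Sym2 (Site d) → Ω → ℝ) (h : Site d → Ω → ℝ) : 0 ≤ qBr μ J h β :=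
  le_limsup_of_frequently_le (Frequently.of_forall fun _ => Real.sqrt_nonneg _)
    (isBoundedUnder_of ⟨1, overlap_std_le_one β J h⟩)

/-- If overlaps above `a` and below `a'` are penalized by the free energy, the broadening is at
most half the distance of `a` and `a'`. -/
theorem qBr_le_half_sub [IsProbabilityMeasure μ] (H : IsDisorder μ J h)
    (hd : 1 ≤ d) {β : ℝ} (hβ : 0 < β) {p : ℝ → ℝ}
    (hp : ∀ lam, Tendsto (fun L : ℕ => ∫ ω,
      |logPartition2 (box d L) β lam (fun e => J e ω) (fun x => h x ω) 0 / (L : ℝ) ^ d - p lam| ∂μ)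
        atTop (𝓝 0)) {lam lam' a a' : ℝ} (haa : a' ≤ a) (h0 : 0 < lam) (h0' : lam' < 0)
    (hlam : p lam - p 0 < β * lam * a) (hlam' : p lam' - p 0 < β * lam' * a') :
    qBr μ J h β ≤ (a - a') / 2 := by
  -- Midpoint and half-width of the window `[a', a]`; `K` dominates `(R - c)²` everywhere because
  -- `|R| ≤ 1`.
  set c := (a + a') / 2 with hc
  set ρ := (a - a') / 2 with hρ
  set K := (1 + |c|) ^ 2 with hK
  have hK0 : 0 ≤ K := by positivity
  set T : ℝ → ℝ → ℕ → ℝ := fun l b L => ∫ ω, gibbs2 (box d L) β 0 (fun e => J e ω)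
    (fun x => h x ω) (fun _ => 0)
      (fun σ₁ σ₂ => if l * b ≤ l * overlap d L σ₁ σ₂ then 1 else 0) ∂μ with hT
  have hind : ∀ (L : ℕ) (l b : ℝ) (σ₁ σ₂ : Config (box d L)),
      |if l * b ≤ l * overlap d L σ₁ σ₂ then (1 : ℝ) else 0| ≤ 1 := fun L l b σ₁ σ₂ => by
    split_ifs <;> norm_num
  -- Pointwise, `(R - c)²` is at most `ρ²` inside the window and at most `K` times the sum of the
  -- two tail indicators outside. Since `lam' < 0`, the second indicator is that of `R ≤ a'`.
  have hle : ∀ L, overlapMoment μ J h β 2 L - overlapMoment μ J h β 1 L ^ 2 ≤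
      ρ ^ 2 + K * (T lam a L + T lam' a' L) := fun L => by
    refine (H.overlap_variance_le β c L).trans ?_
    have h1 := H.integrable_gibbs2 (box d L) β 0 _ (hind L lam a)
    have h2 := H.integrable_gibbs2 (box d L) β 0 _ (hind L lam' a')
    have h12 : Integrable (fun ω => K *
        (gibbs2 (box d L) β 0 (fun e => J e ω) (fun x => h x ω) (fun _ => 0)
          (fun σ₁ σ₂ => if lam * a ≤ lam * overlap d L σ₁ σ₂ then 1 else 0) +
        gibbs2 (box d L) β 0 (fun e => J e ω) (fun x => h x ω) (fun _ => 0)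
          (fun σ₁ σ₂ => if lam' * a' ≤ lam' * overlap d L σ₁ σ₂ then 1 else 0))) μ :=
      (h1.add h2).const_mul K
    have e : ρ ^ 2 + K * (T lam a L + T lam' a' L) = ∫ ω, (ρ ^ 2 + K *
        (gibbs2 (box d L) β 0 (fun e => J e ω) (fun x => h x ω) (fun _ => 0)
          (fun σ₁ σ₂ => if lam * a ≤ lam * overlap d L σ₁ σ₂ then 1 else 0) +
        gibbs2 (box d L) β 0 (fun e => J e ω) (fun x => h x ω) (fun _ => 0)
          (fun σ₁ σ₂ => if lam' * a' ≤ lam' * overlap d L σ₁ σ₂ then 1 else 0))) ∂μ := by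
      rw [integral_add (integrable_const _) h12, integral_const_mul,
        integral_add h1 h2]
      simp [hT]
    rw [e]
    refine integral_mono (H.integrable_gibbs2 _ _ _ _ (K := K) fun σ₁ σ₂ => ?_)
      ((integrable_const _).add h12) fun ω => ?_
    · rw [abs_pow]
      exact pow_le_pow_left₀ (abs_nonneg _)
        ((abs_sub _ _).trans (add_le_add_left (abs_overlap_le_one σ₁ σ₂) _)) 2
    · simp only
      rw [← gibbs2_add, ← gibbs2_const_mul, ← gibbs2_const (box d L) β 0 (fun e => J e ω)
        (fun x => h x ω) (fun _ => 0) (ρ ^ 2), ← gibbs2_add]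
      refine gibbs2_mono _ _ _ _ _ _ fun σ₁ σ₂ => ?_
      set R := overlap d L σ₁ σ₂
      have hRK : (R - c) ^ 2 ≤ K := by
        rw [← sq_abs]
        exact pow_le_pow_left₀ (abs_nonneg _)
          ((abs_sub _ _).trans (add_le_add_left (abs_overlap_le_one σ₁ σ₂) _)) 2
      have hρ0 : 0 ≤ ρ ^ 2 := sq_nonneg _
      split_ifs with h3 h4 h4
      · linarith
      · linarith
      · linarith
      · have h5 : R < a := lt_of_mul_lt_mul_left (not_le.1 h3) h0.le
        have h6 : a' < R := by
          by_contra hcon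
          exact h4 (mul_le_mul_of_nonpos_left (not_lt.1 hcon) h0'.le)
        have : (R - c) ^ 2 ≤ ρ ^ 2 := by
          refine sq_le_sq' ?_ ?_ <;> rw [hc, hρ] <;> linarith
        linarith
  have hlim : Tendsto (fun L => Real.sqrt (ρ ^ 2 + K * (T lam a L + T lam' a' L))) atTop
      (𝓝 (Real.sqrt (ρ ^ 2 + K * (0 + 0)))) :=
    ((((H.tendsto_integral_gibbs2_overlap_tail hd hβ hp hlam).add
      (H.tendsto_integral_gibbs2_overlap_tail hd hβ hp hlam')).const_mul K).const_add _).sqrt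
  rw [add_zero, mul_zero, add_zero, Real.sqrt_sq (by rw [hρ]; linarith)] at hlim
  refine (limsup_le_limsup (Eventually.of_forall fun L => Real.sqrt_le_sqrt (hle L))
    (isCoboundedUnder_le_of_le _ fun _ => Real.sqrt_nonneg _) hlim.isBoundedUnder_le).trans_eq
    hlim.limsup_eq

/-! ### Boundary conditions and convexity in the limit -/

/-- The free energy does not depend on the boundary condition. -/
theorem tendsto_freeEnergy2Box [IsProbabilityMeasure μ] (H : IsDisorder μ J h)
    {β : ℝ} (hβ : 0 < β) {lam p : ℝ}
    (hp : Tendsto (fun L : ℕ => ∫ ω,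
      |logPartition2 (box d L) β lam (fun e => J e ω) (fun x => h x ω) 0 / (L : ℝ) ^ d - p| ∂μ)
        atTop (𝓝 0)) {b : ℕ → Ω → Site d → ℝ} (hb : IsBoundaryCondition b) :
    Tendsto (fun L : ℕ => freeEnergy2Box μ J h β b L lam) atTop (𝓝 (-(1 / β) * p)) := by
  obtain ⟨m, hm0, hm⟩ := H.exists_integral_abs_coupling_le
  have hlim := (((tendsto_card_boundaryBonds_box_div d).const_mul (2 * β * m)).add hp).const_mul
    (1 / β)
  simp only [mul_zero, add_zero] at hlim
  rw [tendsto_iff_dist_tendsto_zero]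
  refine squeeze_zero (fun L => dist_nonneg) (fun L => ?_) hlim
  set F : Ω → ℝ := fun ω => logPartition2 (box d L) β lam (fun e => J e ω) (fun x => h x ω) (b L ω)
    with hF
  set G : Ω → ℝ := fun ω => logPartition2 (box d L) β lam (fun e => J e ω) (fun x => h x ω) 0
    with hG
  -- The comparison is pathwise, before averaging, so the boundary condition may depend on the
  -- disorder.
  have hFG : ∀ ω, |F ω - G ω| ≤ 2 * β * ∑ p ∈ boundaryBonds (box d L), |J s(p.1, p.2) ω| :=
    fun ω => abs_logPartition2_boundary_sub_le hβ.le lam _ _ _ fun u hu => (hb L u hu).2 ω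
  have hGi : Integrable G μ := H.integrable_logPartition2 _ hβ.le lam
  have hFm : AEStronglyMeasurable F μ :=
    (measurable_logPartition2 (J := fun ω e => J e ω) (h := fun ω x => h x ω)
      (b := fun ω => b L ω) H.measurable_coupling H.measurable_field
      (fun u hu => (hb L u hu).1) β lam).aestronglyMeasurable
  have hDi : Integrable (fun ω => F ω - G ω) μ :=
    Integrable.mono' ((H.integrable_sum_boundaryBonds _).const_mul (2 * β))
      (hFm.sub hGi.aestronglyMeasurable) (Eventually.of_forall hFG)
  have hGpi : Integrable (fun ω => G ω / (L : ℝ) ^ d - p) μ :=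
    (hGi.div_const _).sub (integrable_const _)
  have hFi : ∫ ω, F ω ∂μ = ∫ ω, (F ω - G ω) ∂μ + ∫ ω, G ω ∂μ := by
    rw [← integral_add hDi hGi]
    simp
  have h1 : |∫ ω, (F ω - G ω) ∂μ| ≤ 2 * β * ((boundaryBonds (box d L)).card * m) := by
    refine abs_integral_le_integral_abs.trans ?_
    refine (integral_mono hDi.abs ((H.integrable_sum_boundaryBonds _).const_mul (2 * β))
      hFG).trans ?_
    rw [integral_const_mul]
    exact mul_le_mul_of_nonneg_left (H.integral_sum_boundaryBonds_le hm _) (by positivity)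
  have h2 : |∫ ω, (G ω / (L : ℝ) ^ d - p) ∂μ| ≤ ∫ ω, |G ω / (L : ℝ) ^ d - p| ∂μ :=
    abs_integral_le_integral_abs
  have e : freeEnergy2Box μ J h β b L lam - -(1 / β) * p =
      -(1 / β) * ((∫ ω, (F ω - G ω) ∂μ) / (L : ℝ) ^ d + ∫ ω, (G ω / (L : ℝ) ^ d - p) ∂μ) := by
    have : freeEnergy2Box μ J h β b L lam = -(1 / (β * (L : ℝ) ^ d)) * ∫ ω, F ω ∂μ := rfl
    rw [this, integral_sub (hGi.div_const _) (integrable_const _), integral_div, hFi,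
      integral_const, probReal_univ, one_smul]
    ring
  rw [Real.dist_eq, e, abs_mul, abs_neg, abs_of_pos (by positivity : 0 < 1 / β)]
  refine mul_le_mul_of_nonneg_left ((abs_add_le _ _).trans (add_le_add ?_ h2)) (by positivity)
  rw [abs_div, abs_of_nonneg (by positivity : (0 : ℝ) ≤ (L : ℝ) ^ d)]
  refine (div_le_div_of_nonneg_right h1 (by positivity)).trans_eq ?_
  ring

/-- `L¹` convergence gives convergence of the means, and convexity in finite volume survives
averaging and pointwise limits. -/
theorem convexOn_of_tendsto [IsProbabilityMeasure μ] (H : IsDisorder μ J h)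
    {β : ℝ} (hβ : 0 ≤ β) {p : ℝ → ℝ}
    (hp : ∀ lam, Tendsto (fun L : ℕ => ∫ ω,
      |logPartition2 (box d L) β lam (fun e => J e ω) (fun x => h x ω) 0 / (L : ℝ) ^ d - p lam| ∂μ)
        atTop (𝓝 0)) : ConvexOn ℝ Set.univ p := by
  have hi : ∀ L lam, Integrable (fun ω =>
      logPartition2 (box d L) β lam (fun e => J e ω) (fun x => h x ω) 0 / (L : ℝ) ^ d) μ :=
    fun L lam => (H.integrable_logPartition2 _ hβ lam).div_const _
  have hp' : ∀ lam, Tendsto (fun L : ℕ => ∫ ω,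
      logPartition2 (box d L) β lam (fun e => J e ω) (fun x => h x ω) 0 / (L : ℝ) ^ d ∂μ)
        atTop (𝓝 (p lam)) := fun lam => by
    rw [tendsto_iff_dist_tendsto_zero]
    refine squeeze_zero (fun L => dist_nonneg) (fun L => ?_) (hp lam)
    have : ∫ ω, logPartition2 (box d L) β lam (fun e => J e ω) (fun x => h x ω) 0 / (L : ℝ) ^ d ∂μ
        - p lam = ∫ ω, (logPartition2 (box d L) β lam (fun e => J e ω) (fun x => h x ω) 0 /
          (L : ℝ) ^ d - p lam) ∂μ := by
      rw [integral_sub (hi L lam) (integrable_const _)]; simp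
    rw [Real.dist_eq, this]
    exact abs_integral_le_integral_abs
  refine ⟨convex_univ, fun x _ y _ a b ha hb hab => ?_⟩
  refine le_of_tendsto_of_tendsto' (hp' _) (((hp' x).const_smul a).add ((hp' y).const_smul b))
    fun L => ?_
  simp only [smul_eq_mul]
  rw [← integral_const_mul, ← integral_const_mul,
    ← integral_add ((hi L x).const_mul a) ((hi L y).const_mul b)]
  refine integral_mono (hi L _) (((hi L x).const_mul a).add ((hi L y).const_mul b)) fun ω => ?_
  have := (convexOn_logPartition2 (box d L) β (fun e => J e ω) (fun x => h x ω) 0).2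
    (Set.mem_univ x) (Set.mem_univ y) ha hb hab
  simp only [smul_eq_mul] at this
  calc _ ≤ (a * logPartition2 (box d L) β x (fun e => J e ω) (fun x => h x ω) 0 +
        b * logPartition2 (box d L) β y (fun e => J e ω) (fun x => h x ω) 0) / (L : ℝ) ^ d := by
        gcongr
    _ = _ := by ring

end IsDisorder

/-! ### One-sided derivatives of a concave function -/

section Jump

variable {f : ℝ → ℝ}

/-- The free energy is concave, so the statements for convex functions are applied to `-f`. -/
theorem tendsto_deriv_rightFilter (hf : ConvexOn ℝ Set.univ (-f)) :
    Tendsto (deriv f) (rightFilter f) (𝓝 (-derivWithin (-f) (Set.Ioi 0) 0)) := by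
  have := (hf.tendsto_deriv_right 0).neg
  unfold rightFilter
  simpa only [differentiableAt_neg_iff, deriv.neg', neg_neg] using this

theorem tendsto_deriv_leftFilter (hf : ConvexOn ℝ Set.univ (-f)) :
    Tendsto (deriv f) (leftFilter f) (𝓝 (-derivWithin (-f) (Set.Iio 0) 0)) := by
  have := (hf.tendsto_deriv_left 0).neg
  unfold leftFilter
  simpa only [differentiableAt_neg_iff, deriv.neg', neg_neg] using this

theorem countable_not_differentiableAt_of_neg (hf : ConvexOn ℝ Set.univ (-f)) :
    {x | ¬ DifferentiableAt ℝ f x}.Countable := by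
  simpa only [differentiableAt_neg_iff] using hf.countable_not_differentiableAt

end Jump

end EdwardsAnderson

/-! ### The main theorem -/

open EdwardsAnderson

theorem theorem2 {Ω : Type*} [MeasurableSpace Ω] (μ : Measure Ω) [IsProbabilityMeasure μ]
    (d : ℕ) (hd : 1 ≤ d)
    -- couplings (only nearest-neighbour pairs matter) and fields
    (J : Sym2 (Site d) → Ω → ℝ) (h : Site d → Ω → ℝ)
    (hJ_meas : ∀ e ∈ (lattice d).edgeSet, Measurable (J e))
    (hh_meas : ∀ x, Measurable (h x))
    -- all couplings and fields are independent
    (h_indep : iIndepFun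
      (Sum.elim (fun e : (lattice d).edgeSet => J e) h : (lattice d).edgeSet ⊕ Site d → Ω → ℝ) μ)
    -- the couplings are identically distributed, and so are the fields
    (hJ_ident : ∀ e ∈ (lattice d).edgeSet, ∀ e' ∈ (lattice d).edgeSet,
      IdentDistrib (J e) (J e') μ μ)
    (hh_ident : ∀ x y, IdentDistrib (h x) (h y) μ μ)
    -- finite first moments
    (hJ_int : ∀ e ∈ (lattice d).edgeSet, Integrable (J e) μ)
    (hh_int : ∀ x, Integrable (h x) μ)
    (β : ℝ) (hβ : 0 < β) :
    -- the infinite-volume free energy exists, whatever the boundary condition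
    (∀ b : ℕ → Ω → Site d → ℝ, IsBoundaryCondition b → ∀ lam : ℝ,
      Tendsto (fun L : ℕ => freeEnergy2Box μ J h β b L lam) atTop
        (𝓝 (freeEnergy2 μ J h β lam))) ∧
    -- the one-sided limits of its derivative at zero make sense and exist
    {lam : ℝ | ¬ DifferentiableAt ℝ (freeEnergy2 μ J h β) lam}.Countable ∧
    (∃ D : ℝ, Tendsto (deriv (freeEnergy2 μ J h β))
      (rightFilter (freeEnergy2 μ J h β)) (𝓝 D)) ∧
    (∃ D : ℝ, Tendsto (deriv (freeEnergy2 μ J h β))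
      (leftFilter (freeEnergy2 μ J h β)) (𝓝 D)) ∧
    -- the inequality between the order parameters, and its consequence
    qJump μ J h β ≥ qBr μ J h β ^ 2 / 4 ∧
    (0 < qBr μ J h β → ¬ DifferentiableAt ℝ (freeEnergy2 μ J h β) 0) := by
  have H : IsDisorder μ J h :=
    ⟨hJ_meas, hh_meas, h_indep, hJ_ident, hh_ident, hJ_int, hh_int⟩
  choose p hp using fun lam => H.exists_tendsto_integral_abs_sub hd hβ.le lam
  have hopen : IsBoundaryCondition fun (_ : ℕ) (_ : Ω) (_ : Site d) => (0 : ℝ) := fun L u _ =>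
    ⟨measurable_const, fun ω => by simp⟩
  have hf : freeEnergy2 μ J h β = fun lam => -(1 / β) * p lam := funext fun lam =>
    (H.tendsto_freeEnergy2Box hβ (hp lam) hopen).limUnder_eq
  have hneg : -freeEnergy2 μ J h β = (1 / β) • p := by
    rw [hf]
    funext lam
    simp
  have hconv : ConvexOn ℝ Set.univ (-freeEnergy2 μ J h β) := by
    rw [hneg]
    exact (H.convexOn_of_tendsto hβ.le hp).smul (by positivity)
  have hslope : ∀ x y : ℝ, (-freeEnergy2 μ J h β) x - (-freeEnergy2 μ J h β) 0 < y * (x - 0) →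
      p x - p 0 < β * x * y := fun x y hxy => by
    rw [hneg, Pi.smul_apply, Pi.smul_apply, smul_eq_mul, smul_eq_mul, ← mul_sub, sub_zero,
      one_div, inv_mul_lt_iff₀ hβ] at hxy
    linarith
  have hcount := countable_not_differentiableAt_of_neg hconv
  have hright := tendsto_deriv_rightFilter hconv
  have hleft := tendsto_deriv_leftFilter hconv
  set r := derivWithin (-freeEnergy2 μ J h β) (Set.Ioi 0) 0 with hr
  set l := derivWithin (-freeEnergy2 μ J h β) (Set.Iio 0) 0 with hl
  have hlr : l ≤ r := hconv.leftDeriv_le_rightDeriv_of_mem_interior (by simp)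
  have hjump : qJump μ J h β = (r - l) / 2 := by
    -- Evaluating `limUnder` needs a nontrivial filter; differentiability off a countable set
    -- provides it.
    have : (rightFilter (freeEnergy2 μ J h β)).NeBot :=
      neBot_nhdsWithin_gt_of_countable hcount 0
    have : (leftFilter (freeEnergy2 μ J h β)).NeBot :=
      neBot_nhdsWithin_lt_of_countable hcount 0
    rw [qJump, hright.limUnder_eq, hleft.limUnder_eq]
    ring
  -- The window `[l - ε, r + ε]` has half-width `(r - l) / 2 + ε`, that is, the jump plus `ε`.
  have hbr : qBr μ J h β ≤ qJump μ J h β := by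
    refine le_of_forall_pos_le_add fun ε hε => ?_
    obtain ⟨x, hx, hx'⟩ := hconv.exists_lt_of_derivWithin_Ioi_lt (show r < r + ε by linarith)
    obtain ⟨y, hy, hy'⟩ := hconv.exists_lt_of_lt_derivWithin_Iio (show l - ε < l by linarith)
    have := H.qBr_le_half_sub hd hβ hp (a := r + ε) (a' := l - ε) (by linarith) hx hy
      (hslope x _ hx') (hslope y _ hy')
    rw [hjump]
    linarith
  have h0 := IsDisorder.qBr_nonneg (μ := μ) β J h
  have h1 := IsDisorder.qBr_le_one (μ := μ) β J h
  refine ⟨fun b hb lam => ?_, hcount, ⟨_, hright⟩, ⟨_, hleft⟩, ?_, fun hpos hdiff => ?_⟩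
  · rw [hf]
    exact H.tendsto_freeEnergy2Box hβ (hp lam) hb
  -- Since `0 ≤ q_br ≤ 1`, one has `q_br² / 4 ≤ q_br ≤ q_jump`.
  · nlinarith
  -- Differentiability at zero would force `l = r`, so the jump, and with it `q_br`, could not be
  -- positive.
  · have hD := hdiff.neg.hasDerivAt
    have hr' : r = deriv (-freeEnergy2 μ J h β) 0 :=
      hD.hasDerivWithinAt.derivWithin (uniqueDiffWithinAt_Ioi 0)
    have hl' : l = deriv (-freeEnergy2 μ J h β) 0 :=
      hD.hasDerivWithinAt.derivWithin (uniqueDiffWithinAt_Iio 0)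
    rw [hjump, hr', hl'] at hbr
    linarith
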